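/- **Setting.** Let $n,N,p\ge 1$ be integers, let $\mathbf D$ be a non-random complex $n\times N$ matrix and let $\mathbf X$ be an $n\times N$ standard complex Gaussian matrix (the real and imaginary parts of all entries are independent, each $N(0,\tfrac12)$). Put $\mathbf Y=\mathbf D+\mathbf X$. With $\mathrm{tr}$ the normalized trace, write $D_l=\mathrm{tr}\big((\tfrac1N\mathbf D\mathbf D^H)^l\big)$, $Y_l=\mathrm{tr}\big((\tfrac1N\mathbf Y\mathbf Y^H)^l\big)$, $D_{l_1,\dots,l_r}=D_{l_1}\cdots D_{l_r}$, $Y_{l_1,\dots,l_r}=Y_{l_1}\cdots Y_{l_r}$ (the empty product being $1$). **Partial permutations.** $\mathrm{SP}_m$ is the set of partial permutations $\pi=\pi(\rho_1,\rho_2,q)$ of $\{1,\dots,m\}$: bijections $q:\rho_1\to\rho_2$ between two (possibly empty) subsets of $\{1,\dots,m\}$. Let $m=p_1+\cdots+p_k$ and draw $k$ disjoint circles with $2p_1,\dots,2p_k$ edges, the edges being numbered clockwise from $1$ to $2m$ and the vertices likewise, so that edge $i$ runs from vertex $i$ to the next vertex on its circle (vertex $i+1$, except for the last edge of a circle, which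 returns to the first vertex of that circle). For each $i\in\rho_1$ with $q(i)=j$, identify edge $2i$ with edge $2j-1$ with opposite orientation. The edges $2i$ ($i\in\rho_1$) and $2j-1$ ($j\in\rho_2$) are called random, the others deterministic. Let $\rho(\pi)$ be the resulting partition of the vertices; each of its blocks consists of even vertices only or of odd vertices only. Let $k(\rho(\pi))$ (resp. $l(\rho(\pi))$) be the number of even (resp. odd) blocks and $kd(\rho(\pi))$ (resp. $ld(\rho(\pi))$) the number of those that border to a deterministic edge. Let $\sigma(\pi)$ be the partition of the deterministic edges into connected components after the identification, $|\sigma(\pi)|$ its number of blocks, and $l_1,\dots,l_r$ the cardinalities of its blocks divided by $2$. Put $$P_\pi(n,N)=N^{k(\rho(\pi))-kd(\rho(\pi))}\,n^{l(\rho(\pi))-ld(\rho(\pi))}.$$ **Estimator.** Using one circle with $2p$ edges, let $$\widehat{D_p}=\sum_{\pi\in\mathrm{SP}_p}(-1)^{|\rho_1|}\,\frac{n^{|\sigma(\pi)|-1}}{N^{|\rho_1|}}\,P_\pi(n,N)\,Y_{l_1,\dots,l_r}.$$ **Lemma.** Let $\mathrm{SPR}_{2p}$ be the set of nonempty partial permutations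 of $\{1,\dots,2p\}$ (drawn on two circles with $2p$ edges each) all of whose identifications $i\mapsto q(i)$ go from $\{1,\dots,p\}$ to $\{p+1,\dots,2p\}$ or from $\{p+1,\dots,2p\}$ to $\{1,\dots,p\}$ (both kinds may occur in the same $\pi$). Then $\widehat{D_p}$ is square integrable, its variance is $$v_p=\mathbb E\big[\widehat{D_p}^2\big]-\mathbb E\big[\widehat{D_p}\big]^2=\sum_{\pi\in\mathrm{SPR}_{2p}}\frac{n^{|\sigma(\pi)|-2}}{N^{|\rho_1|}}\,P_\pi(n,N)\,D_{l_1,\dots,l_r},$$ and every term of this sum is nonnegative. -/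

import Mathlib

open MeasureTheory ProbabilityTheory
open scoped Matrix

namespace GaussianMoments

section Gaussian

variable {Ω : Type*} [MeasurableSpace Ω] {n N : ℕ}

/-- The real (`true`) or imaginary (`false`) part of an entry of a random complex matrix. -/
def entryPart (X : Ω → Matrix (Fin n) (Fin N) ℂ) (t : (Fin n × Fin N) × Bool) (ω : Ω) : ℝ :=
  if t.2 then (X ω t.1.1 t.1.2).re else (X ω t.1.1 t.1.2).im

/-- `X` is a standard complex Gaussian matrix: the real and imaginary parts of all its entries
are independent real Gaussian variables with mean zero and variance `1 / 2`. -/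
structure IsStandardComplexGaussian (X : Ω → Matrix (Fin n) (Fin N) ℂ) (μ : Measure Ω) :
    Prop where
  indep : iIndepFun (entryPart X) μ
  law : ∀ t, HasLaw (entryPart X t) (gaussianReal 0 (1 / 2)) μ

/-- The moment `tr (((1 / N) A Aᴴ) ^ p)`, with `tr` the normalized trace. The trace is a real
number (see `moment_eq`), so it is recorded as a real number. -/
noncomputable def moment (A : Matrix (Fin n) (Fin N) ℂ) (p : ℕ) : ℝ :=
  ((n : ℂ)⁻¹ * (((N : ℂ)⁻¹ • (A * Aᴴ)) ^ p).trace).re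

theorem moment_eq (A : Matrix (Fin n) (Fin N) ℂ) (p : ℕ) :
    (moment A p : ℂ) = (n : ℂ)⁻¹ * (((N : ℂ)⁻¹ • (A * Aᴴ)) ^ p).trace := by
  have h : ((((N : ℂ)⁻¹ • (A * Aᴴ)) ^ p))ᴴ = ((N : ℂ)⁻¹ • (A * Aᴴ)) ^ p := by
    simp [Matrix.conjTranspose_pow, Matrix.conjTranspose_smul, Matrix.conjTranspose_mul]
  unfold moment
  apply Complex.conj_eq_iff_re.mp
  have h2 := congrArg Matrix.trace h
  rw [Matrix.trace_conjTranspose] at h2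
  rw [map_mul]
  congr 1
  · simp

end Gaussian

section PartialPermutations

/-! A partial permutation of a finite set `ι`, i.e. a bijection `q` between two subsets `ρ₁`, `ρ₂`
of `ι`, is a term of Mathlib's type `ι ≃. ι`; `j ∈ π i` means `i ∈ ρ₁` and `q i = j`. -/

variable {ι : Type*} [Fintype ι] [DecidableEq ι]

noncomputable instance : Fintype (ι ≃. ι) :=
  Fintype.ofInjective (fun π : ι ≃. ι => (π : ι → Option ι)) DFunLike.coe_injective

/-- The domain of a partial permutation. -/
def rho₁ (π : ι ≃. ι) : Finset ι := Finset.univ.filter fun i => (π i).isSome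

/-- The range of a partial permutation. -/
def rho₂ (π : ι ≃. ι) : Finset ι := Finset.univ.filter fun j => (π.symm j).isSome

/-! A collection of disjoint circles is described by a permutation `next` of a finite set `ι`, one
circle for each cycle. The circle through `i` has, in clockwise order, the odd edge and the even
edge of `i`, then those of `next i`, and so on. With `ι = {1, …, p}` these are the edges numbered
`2 * i - 1` and `2 * i`. -/

/-- The edges: `odd i` is the edge `2 * i - 1`, `even i` is the edge `2 * i`. -/
inductive Edge (ι : Type*)
  | odd (i : ι)
  | even (i : ι)

/-- The vertices: `odd i` is the vertex `2 * i - 1`, `even i` is the vertex `2 * i`. -/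
inductive Vertex (ι : Type*)
  | odd (i : ι)
  | even (i : ι)

/-- Whether a vertex has an even number. -/
def Vertex.IsEven : Vertex ι → Prop
  | .odd _ => False
  | .even _ => True

/-- The first vertex of an edge in clockwise order: edge number `m` starts at vertex `m`. -/
def Edge.source : Edge ι → Vertex ι
  | .odd i => .odd i
  | .even i => .even i

/-- The second vertex of an edge in clockwise order: edge number `m` ends at vertex `m + 1`,
cyclically on its circle. -/
def Edge.target (next : Equiv.Perm ι) : Edge ι → Vertex ι
  | .odd i => .even i
  | .even i => .odd (next i)

/-- A vertex borders to an edge if it is one of its two ends. -/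
def Edge.Borders (next : Equiv.Perm ι) (e : Edge ι) (v : Vertex ι) : Prop :=
  v = e.source ∨ v = e.target next

/-- Random edges: the even edges of `ρ₁` and the odd edges of `ρ₂`. -/
def IsRandom (π : ι ≃. ι) : Edge ι → Prop
  | .odd j => j ∈ rho₂ π
  | .even i => i ∈ rho₁ π

/-- Deterministic edges are those that are not random. -/
abbrev DetEdge (π : ι ≃. ι) : Type _ := {e : Edge ι // ¬ IsRandom π e}

/-- Two vertices are glued when, for some `i` with `q i = j`, the even edge of `i` and the odd edge
of `j` are identified with opposite orientation. -/
def Glued (next : Equiv.Perm ι) (π : ι ≃. ι) (v w : Vertex ι) : Prop :=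
  ∃ i j, j ∈ π i ∧
    ((v = (Edge.even i).source ∧ w = (Edge.odd j).target next) ∨
      (v = (Edge.even i).target next ∧ w = (Edge.odd j).source))

/-- The partition `ρ(π)` of the vertices after the identification of edges. -/
def vertexSetoid (next : Equiv.Perm ι) (π : ι ≃. ι) : Setoid (Vertex ι) :=
  Relation.EqvGen.setoid (Glued next π)

/-- The blocks of `ρ(π)`. -/
abbrev VertexBlock (next : Equiv.Perm ι) (π : ι ≃. ι) : Type _ := Quotient (vertexSetoid next π)

/-- A block consisting of even vertices only. -/
def IsEvenBlock (next : Equiv.Perm ι) (π : ι ≃. ι) (c : VertexBlock next π) : Prop :=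
  ∀ v : Vertex ι, (Quotient.mk _ v : VertexBlock next π) = c → v.IsEven

/-- A block consisting of odd vertices only. -/
def IsOddBlock (next : Equiv.Perm ι) (π : ι ≃. ι) (c : VertexBlock next π) : Prop :=
  ∀ v : Vertex ι, (Quotient.mk _ v : VertexBlock next π) = c → ¬ v.IsEven

/-- A block containing a vertex that borders to a deterministic edge. -/
def BordersDet (next : Equiv.Perm ι) (π : ι ≃. ι) (c : VertexBlock next π) : Prop :=
  ∃ (v : Vertex ι) (e : DetEdge π), Quotient.mk _ v = c ∧ e.1.Borders next v

/-- `k(ρ(π))`. -/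
noncomputable def kBlocks (next : Equiv.Perm ι) (π : ι ≃. ι) : ℕ :=
  {c | IsEvenBlock next π c}.ncard

/-- `kd(ρ(π))`. -/
noncomputable def kdBlocks (next : Equiv.Perm ι) (π : ι ≃. ι) : ℕ :=
  {c | IsEvenBlock next π c ∧ BordersDet next π c}.ncard

/-- `l(ρ(π))`. -/
noncomputable def lBlocks (next : Equiv.Perm ι) (π : ι ≃. ι) : ℕ :=
  {c | IsOddBlock next π c}.ncard

/-- `ld(ρ(π))`. -/
noncomputable def ldBlocks (next : Equiv.Perm ι) (π : ι ≃. ι) : ℕ :=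
  {c | IsOddBlock next π c ∧ BordersDet next π c}.ncard

/-- `P_π(n, N) = N ^ (k(ρ(π)) - kd(ρ(π))) * n ^ (l(ρ(π)) - ld(ρ(π)))`. -/
noncomputable def vertexFactor (next : Equiv.Perm ι) (π : ι ≃. ι) (n N : ℕ) : ℝ :=
  (N : ℝ) ^ ((kBlocks next π : ℤ) - kdBlocks next π) *
    (n : ℝ) ^ ((lBlocks next π : ℤ) - ldBlocks next π)

/-- The partition `σ(π)` of the deterministic edges into connected components after the
identification of edges: it is generated by joining two deterministic edges whenever they border
to a common block of vertices. -/
def edgeSetoid (next : Equiv.Perm ι) (π : ι ≃. ι) : Setoid (DetEdge π) :=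
  Relation.EqvGen.setoid fun e f => ∃ v w : Vertex ι,
    e.1.Borders next v ∧ f.1.Borders next w ∧ vertexSetoid next π v w

/-- The blocks of `σ(π)`. -/
abbrev EdgeBlock (next : Equiv.Perm ι) (π : ι ≃. ι) : Type _ := Quotient (edgeSetoid next π)

instance : Finite (Edge ι) :=
  Finite.of_surjective (fun s : ι ⊕ ι => s.elim Edge.odd Edge.even) fun e => by
    cases e with
    | odd i => exact ⟨.inl i, rfl⟩
    | even i => exact ⟨.inr i, rfl⟩

instance : Finite (Vertex ι) :=
  Finite.of_surjective (fun s : ι ⊕ ι => s.elim Vertex.odd Vertex.even) fun e => by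
    cases e with
    | odd i => exact ⟨.inl i, rfl⟩
    | even i => exact ⟨.inr i, rfl⟩

noncomputable instance (next : Equiv.Perm ι) (π : ι ≃. ι) : Fintype (EdgeBlock next π) :=
  Fintype.ofFinite _

/-- `|σ(π)|`. -/
noncomputable def sigmaCard (next : Equiv.Perm ι) (π : ι ≃. ι) : ℕ :=
  Fintype.card (EdgeBlock next π)

/-- Half the number of edges in a block of `σ(π)`. -/
noncomputable def halfCard (next : Equiv.Perm ι) (π : ι ≃. ι) (b : EdgeBlock next π) : ℕ :=
  {e : DetEdge π | Quotient.mk _ e = b}.ncard / 2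

/-- `A_{l₁, …, l_r} = A_{l₁} ⋯ A_{l_r}`, where `A_l` is the `l`-th moment of `A` and `l₁, …, l_r`
are the cardinalities of the blocks of `σ(π)` divided by two. It is `1` if `σ(π)` has no block. -/
noncomputable def momentProd {n N : ℕ} (A : Matrix (Fin n) (Fin N) ℂ) (next : Equiv.Perm ι)
    (π : ι ≃. ι) : ℝ :=
  ∏ b : EdgeBlock next π, moment A (halfCard next π b)

/-- `(n ^ (|σ(π)| - k) / N ^ |ρ₁|) * P_π(n, N)`. -/
noncomputable def weight (next : Equiv.Perm ι) (k : ℕ) (n N : ℕ) (π : ι ≃. ι) : ℝ :=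
  (n : ℝ) ^ ((sigmaCard next π : ℤ) - k) / (N : ℝ) ^ (rho₁ π).card * vertexFactor next π n N

end PartialPermutations

/-- The estimator of the `p`-th moment, evaluated at the observation `Y`. The sum is over all
partial permutations of `{1, …, p}`, drawn on a single circle with `2 * p` edges. -/
noncomputable def estimator {n N : ℕ} (p : ℕ) (Y : Matrix (Fin n) (Fin N) ℂ) : ℝ :=
  ∑ π : Fin p ≃. Fin p,
    (-1) ^ (rho₁ π).card * weight (finRotate p) 1 n N π * momentProd Y (finRotate p) π

/-- Two circles with `2 * p` edges each. The set `{1, …, 2 * p}` is written as `Fin p ⊕ Fin p`, the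
left summand being `{1, …, p}` and the right one `{p + 1, …, 2 * p}`. -/
def twoCircles (p : ℕ) : Equiv.Perm (Fin p ⊕ Fin p) :=
  Equiv.sumCongr (finRotate p) (finRotate p)

open Classical in
/-- The nonempty partial permutations of `{1, …, 2 * p}` all of whose identifications go from
`{1, …, p}` to `{p + 1, …, 2 * p}` or from `{p + 1, …, 2 * p}` to `{1, …, p}`. -/
noncomputable def SPR (p : ℕ) : Finset ((Fin p ⊕ Fin p) ≃. (Fin p ⊕ Fin p)) :=
  Finset.univ.filter fun π => (rho₁ π).Nonempty ∧ ∀ i j, j ∈ π i → i.isLeft ≠ j.isLeft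

end GaussianMoments

open GaussianMoments

/-! Label the odd vertices by row indices `f` and the even vertices by column indices `g`. The
traces become sums over labellings: the odd edge of `j` carries the entry `(f j, g j)` and the even
edge of `i` the conjugate of the entry `(f (next i), g i)`. Identifying two edges amounts to a
Kronecker delta between their entries. For any matrix, the `π`-term of either sum is, up to the
normalization `1 / (n ^ k * N ^ |ι|)` (with the sign factored out for the estimator), the sum over
labellings of the corresponding deltas times the entries at the deterministic edges
(`weight_mul_momentProd`). A vertex class without deterministic edge has a free label and gives a
factor `N` or `n`; each component of deterministic edges closes up to the trace of a power of `A *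
Aᴴ` (`sum_graphTerm`).

Because of the sign `(-1) ^ |ρ₁|`, the estimator is therefore a normalized sum of Wick polynomials
of the entries of `D + X`, that is, of sums over all partial pairings with coefficient `-δ` on each
pair. By Wick's theorem (`integral_pairSum`), expectation adds `δ` to the coefficient of every pair
and replaces unpaired entries by those of `D`. In the square of the estimator, pairs inside one
circle get `-δ + δ = 0`, while pairs joining the two circles get `0 + δ = δ`. Only pairings between
the circles survive. The squared mean is the contribution of the empty pairing; subtracting it
leaves exactly `SPR p`.

Square integrability holds since the estimator is a polynomial in Gaussian variables, and
nonnegativity since moments of positive semidefinite matrices are nonnegative. -/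

namespace GaussianMoments

/-! ### Gaussian integration by parts for polynomials. -/

section Stein

open MvPolynomial

/-- Integration by parts for the monomials under a centred Gaussian law. -/
theorem integral_pow_succ_gaussianReal {v : NNReal} (hv : v ≠ 0) (m : ℕ) :
    ∫ x, (x ^ (m + 1) : ℝ) ∂(gaussianReal 0 v) =
      v * (m * ∫ x, (x ^ (m - 1) : ℝ) ∂(gaussianReal 0 v)) := by
  have hv' : (0 : ℝ) < v := by positivity
  set b : ℝ := (2 * (v : ℝ))⁻¹ with hb
  have hb0 : 0 < b := by positivity
  have key (k : ℕ) : ∫ x, (x ^ k : ℝ) ∂(gaussianReal 0 v) =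
      (√(2 * Real.pi * v))⁻¹ * ∫ x : ℝ, x ^ k * Real.exp (-b * x ^ 2) := by
    rw [integral_gaussianReal_eq_integral_smul hv, ← integral_const_mul]
    refine integral_congr_ae (.of_forall fun x => ?_)
    simp only [gaussianPDFReal, smul_eq_mul, hb]
    rw [show -(x - 0) ^ 2 / (2 * (v : ℝ)) = -(2 * (v : ℝ))⁻¹ * x ^ 2 by field_simp; ring]
    ring
  have hint (k : ℕ) : Integrable fun x : ℝ => x ^ k * Real.exp (-b * x ^ 2) := by
    have := integrable_rpow_mul_exp_neg_mul_sq hb0 (s := (k : ℝ))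
      (by have : (0 : ℝ) ≤ k := by positivity
          linarith)
    simpa using this
  -- The integral of this derivative over the line vanishes, which is the recursion. For `m = 0` the
  -- truncated exponent `m - 1` is harmless because of the factor `m`.
  have hd (x : ℝ) : HasDerivAt (fun x : ℝ => x ^ m * Real.exp (-b * x ^ 2))
      (m * (x ^ (m - 1) * Real.exp (-b * x ^ 2)) -
        2 * b * (x ^ (m + 1) * Real.exp (-b * x ^ 2))) x := by
    have h1 : HasDerivAt (fun x : ℝ => -b * x ^ 2) (-b * (2 * x)) x := by
      simpa using (hasDerivAt_pow 2 x).const_mul (-b)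
    refine ((hasDerivAt_pow m x).mul h1.exp).congr_deriv ?_
    ring
  have h0 := integral_eq_zero_of_hasDerivAt_of_integrable hd
    (((hint _).const_mul _).sub ((hint _).const_mul _)) (hint m)
  rw [integral_sub ((hint _).const_mul _) ((hint _).const_mul _), integral_const_mul,
    integral_const_mul] at h0
  rw [key, key]
  have h2 : (∫ x : ℝ, x ^ (m + 1) * Real.exp (-b * x ^ 2)) =
      v * (m * ∫ x : ℝ, x ^ (m - 1) * Real.exp (-b * x ^ 2)) := by
    have : 2 * b * v = 1 := by rw [hb]; field_simp
    linear_combination (-(v : ℝ)) * h0 -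
      (∫ x : ℝ, x ^ (m + 1) * Real.exp (-b * x ^ 2)) * this
  rw [h2]
  ring

variable {Ω T : Type*} [MeasurableSpace Ω] {μ : Measure Ω} {x : T → Ω → ℝ} {v : NNReal}

/-- Multiplying by one more variable uses Hölder's inequality with both factors in `L^{2q}`, so the
induction runs over all finite exponents at once. -/
theorem memLp_eval_gaussian [IsProbabilityMeasure μ] (hx : ∀ t, HasLaw (x t) (gaussianReal 0 v) μ)
    (P : MvPolynomial T ℂ) (q : ENNReal) (hq : q ≠ ⊤) :
    MemLp (fun ω => eval (fun t => (x t ω : ℂ)) P) q μ := by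
  induction P using MvPolynomial.induction_on generalizing q with
  | C a => simpa using memLp_const a
  | add P Q hP hQ => exact ((hP q hq).add (hQ q hq)).ae_eq (.of_forall fun ω => by simp)
  | mul_X P t hP =>
    have h2 : 2 * q ≠ ⊤ := ENNReal.mul_ne_top (by simp) hq
    have hX : MemLp (fun ω => (x t ω : ℂ)) (2 * q) μ := by
      have h1 := memLp_id_gaussianReal' (μ := 0) (v := v) (2 * q) h2
      have h3 : MemLp (x t) (2 * q) μ := by
        rw [← (hx t).map_eq] at h1
        exact h1.comp_of_map (hx t).aemeasurable
      exact h3.ofReal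
    have : ENNReal.HolderTriple (2 * q) (2 * q) q := ⟨by
      rw [ENNReal.mul_inv (by simp) (by simp), ← add_mul, ENNReal.inv_two_add_inv_two, one_mul]⟩
    simpa using hX.mul' (hP _ h2)

theorem integrable_eval_gaussian [IsProbabilityMeasure μ] (hx : ∀ t, HasLaw (x t) (gaussianReal 0 v) μ)
    (P : MvPolynomial T ℂ) : Integrable (fun ω => eval (fun t => (x t ω : ℂ)) P) μ :=
  memLp_one_iff_integrable.1 (memLp_eval_gaussian hx P 1 (by simp))

theorem integral_monomial_gaussian [Fintype T] (hx : ∀ t, HasLaw (x t) (gaussianReal 0 v) μ)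
    (hi : iIndepFun x μ) (s : T →₀ ℕ) :
    ∫ ω, eval (fun t => (x t ω : ℂ)) (monomial s (1 : ℂ)) ∂μ =
      ∏ t, ((∫ y, y ^ s t ∂(gaussianReal 0 v) : ℝ) : ℂ) := by
  have h1 : ∀ y : T → ℝ, eval (fun t => (y t : ℂ)) (monomial s (1 : ℂ)) =
      ((∏ t, y t ^ s t : ℝ) : ℂ) := by
    intro y
    rw [eval_monomial, Finsupp.prod_fintype _ _ (by simp)]
    simp
  simp_rw [h1]
  rw [integral_complex_ofReal, ← Complex.ofReal_prod, ← integral_fintype_prod_eq_prod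
    (fun t (y : ℝ) => y ^ s t)]
  congr 1
  have := (hi.hasLaw_pi hx).integral_comp (f := fun y : T → ℝ => ∏ t, y t ^ s t)
    (Continuous.aestronglyMeasurable (by fun_prop))
  exact this

/-- Integration by parts for polynomials in independent centred Gaussian variables. -/
theorem integral_X_mul_gaussian [IsProbabilityMeasure μ] [Fintype T] (hx : ∀ t, HasLaw (x t) (gaussianReal 0 v) μ) (hv : v ≠ 0)
    (hi : iIndepFun x μ) (t : T) (P : MvPolynomial T ℂ) :
    ∫ ω, eval (fun t => (x t ω : ℂ)) (X t * P) ∂μ =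
      (v : ℂ) * ∫ ω, eval (fun t => (x t ω : ℂ)) (pderiv t P) ∂μ := by
  classical
  induction P using MvPolynomial.induction_on' with
  | add P Q hP hQ =>
    simp only [mul_add, map_add]
    rw [integral_add (integrable_eval_gaussian hx _) (integrable_eval_gaussian hx _),
      integral_add (integrable_eval_gaussian hx _) (integrable_eval_gaussian hx _), hP, hQ, mul_add]
  | monomial s a =>
    have e1 : (X t * monomial s a : MvPolynomial T ℂ) =
        C a * monomial (s + Finsupp.single t 1) 1 := by
      rw [C_mul_monomial, mul_comm, X, monomial_mul]
    -- If `s t = 0`, the truncated exponent does not matter, the coefficient being zero.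
    have e2 : (pderiv t (monomial s a) : MvPolynomial T ℂ) =
        C (a * s t) * monomial (s - Finsupp.single t 1) 1 := by
      rw [pderiv_monomial, C_mul_monomial, mul_one]
    rw [e1, e2]
    simp only [map_mul, eval_C]
    rw [integral_const_mul, integral_const_mul, integral_monomial_gaussian hx hi,
      integral_monomial_gaussian hx hi, ← Finset.mul_prod_erase _ _ (Finset.mem_univ t),
      ← Finset.mul_prod_erase _ (fun u => ((∫ y, y ^ ((s - Finsupp.single t 1 : T →₀ ℕ) u)
        ∂(gaussianReal 0 v) : ℝ) : ℂ)) (Finset.mem_univ t)]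
    have e3 : ∏ u ∈ Finset.univ.erase t,
        ((∫ y, y ^ (s + Finsupp.single t 1 : T →₀ ℕ) u ∂(gaussianReal 0 v) : ℝ) : ℂ) =
        ∏ u ∈ Finset.univ.erase t,
        ((∫ y, y ^ (s - Finsupp.single t 1 : T →₀ ℕ) u ∂(gaussianReal 0 v) : ℝ) : ℂ) := by
      refine Finset.prod_congr rfl fun u hu => ?_
      simp [Finset.ne_of_mem_erase hu]
    rw [e3]
    simp only [Finsupp.add_apply, Finsupp.single_eq_same, Finsupp.tsub_apply]
    rw [integral_pow_succ_gaussianReal hv]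
    push_cast
    ring

end Stein

/-! ### Sums over partial pairings and their recursion. -/

section PairSum

variable {ι κ R : Type*} [Fintype ι] [DecidableEq ι] [Fintype κ] [DecidableEq κ] [CommRing R]

/-- Partial injections, with domain in `A` and range in `B`. -/
def IsPartialInj (A B : Finset ι) (f : ι → Option ι) : Prop :=
  (∀ i, i ∉ A → f i = none) ∧ (∀ i, ∀ j ∈ f i, j ∈ B) ∧ ∀ i i', ∀ j ∈ f i, j ∈ f i' → i = i'

open Classical in
/-- The partial injections as a finset. -/
noncomputable def partialInj (A B : Finset ι) : Finset (ι → Option ι) :=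
  Finset.univ.filter (IsPartialInj A B)

theorem mem_partialInj {A B : Finset ι} {f : ι → Option ι} :
    f ∈ partialInj A B ↔ IsPartialInj A B f := by
  simp [partialInj]

/-- The contribution of one partial injection to `pairSum`. -/
noncomputable def pairTerm (c : ι → ι → R) (u v : ι → R) (A B : Finset ι) (f : ι → Option ι) : R :=
  (∏ i ∈ A, (f i).elim (v i) (c i)) * ∏ j ∈ B with ∀ i, f i ≠ some j, u j

/-- The sum over the partial injections `f` from `A` to `B` of the products of the `c i j` with
`f i = j`, of the `v i` with `i` outside the domain and of the `u j` with `j` outside the range. -/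
noncomputable def pairSum (c : ι → ι → R) (u v : ι → R) (A B : Finset ι) : R :=
  ∑ f ∈ partialInj A B, pairTerm c u v A B f

theorem pairSum_empty (c : ι → ι → R) (u v : ι → R) (B : Finset ι) :
    pairSum c u v ∅ B = ∏ j ∈ B, u j := by
  have : partialInj ∅ B = {fun _ => none} := by
    ext f
    simp only [mem_partialInj, Finset.mem_singleton]
    constructor
    · intro h
      funext i
      exact h.1 i (by simp)
    · rintro rfl
      simp [IsPartialInj]
  rw [pairSum, this]
  simp [pairTerm]

theorem update_mem_partialInj {A B : Finset ι} {a j : ι} (ha : a ∉ A) (hj : j ∈ B)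
    {f : ι → Option ι} (hf : f ∈ partialInj A (B.erase j)) :
    Function.update f a (some j) ∈ partialInj (insert a A) B := by
  rw [mem_partialInj] at hf ⊢
  obtain ⟨h1, h2, h3⟩ := hf
  refine ⟨fun i hi => ?_, fun i k hk => ?_, fun i i' k hk hk' => ?_⟩
  · rw [Finset.mem_insert, not_or] at hi
    rw [Function.update_of_ne hi.1]
    exact h1 i hi.2
  · by_cases hi : i = a
    · subst hi
      simp at hk
      exact hk ▸ hj
    · rw [Function.update_of_ne hi] at hk
      exact Finset.mem_of_mem_erase (h2 i k hk)
  · have h4 : ∀ i k, k ∈ f i → k ≠ j := fun i k hk => Finset.ne_of_mem_erase (h2 i k hk)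
    by_cases hi : i = a <;> by_cases hi' : i' = a
    · rw [hi, hi']
    · subst hi
      rw [Function.update_of_ne hi'] at hk'
      simp at hk
      exact absurd hk.symm (h4 _ _ hk')
    · subst hi'
      rw [Function.update_of_ne hi] at hk
      simp at hk'
      exact absurd hk'.symm (h4 _ _ hk)
    · rw [Function.update_of_ne hi] at hk
      rw [Function.update_of_ne hi'] at hk'
      exact h3 _ _ _ hk hk'

theorem update_none_mem_partialInj {A B : Finset ι} {a j : ι}
    {f : ι → Option ι} (hf : f ∈ partialInj (insert a A) B) (hfa : f a = some j) :
    Function.update f a none ∈ partialInj A (B.erase j) := by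
  rw [mem_partialInj] at hf ⊢
  obtain ⟨h1, h2, h3⟩ := hf
  refine ⟨fun i hi => ?_, fun i k hk => ?_, fun i i' k hk hk' => ?_⟩
  · by_cases h : i = a
    · simp [h]
    · rw [Function.update_of_ne h]
      exact h1 i (by simp [h, hi])
  · by_cases h : i = a
    · simp [h] at hk
    · rw [Function.update_of_ne h] at hk
      refine Finset.mem_erase.2 ⟨?_, h2 i k hk⟩
      rintro rfl
      exact h (h3 _ _ _ hk hfa)
  · by_cases h : i = a
    · simp [h] at hk
    · by_cases h' : i' = a
      · simp [h'] at hk'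
      · rw [Function.update_of_ne h] at hk
        rw [Function.update_of_ne h'] at hk'
        exact h3 _ _ _ hk hk'

/-- Split according to the fate of `a`: it is unpaired, or it is paired with some `j`, which then is
no longer available to the others. This recursion replaces the combinatorics of pairings in the
inductions on `A` below. -/
theorem pairSum_insert (c : ι → ι → R) (u v : ι → R) {A : Finset ι} {a : ι} (ha : a ∉ A)
    (B : Finset ι) :
    pairSum c u v (insert a A) B =
      v a * pairSum c u v A B + ∑ j ∈ B, c a j * pairSum c u v A (B.erase j) := by
  have hT (g : Option ι → Finset (ι → Option ι))
      (hg : ∀ o f, f ∈ g o ↔ f ∈ partialInj (insert a A) B ∧ f a = o) :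
      pairSum c u v (insert a A) B = ∑ f ∈ g none, pairTerm c u v (insert a A) B f +
        ∑ j ∈ B, ∑ f ∈ g (some j), pairTerm c u v (insert a A) B f := by
    rw [pairSum, ← Finset.sum_fiberwise_of_maps_to (t := insert none (B.image some))
      (g := fun f => f a), Finset.sum_insert (by simp), Finset.sum_image (by simp)]
    · congr 1
      · exact Finset.sum_congr (by ext f; simp [hg]) fun _ _ => rfl
      · exact Finset.sum_congr rfl fun j _ =>
          Finset.sum_congr (by ext f; simp [hg]) fun _ _ => rfl
    · intro f hf
      rw [mem_partialInj] at hf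
      rcases hfa : f a with _ | j
      · simp
      · simpa using hf.2.1 a j hfa
  rw [hT (fun o => (partialInj (insert a A) B).filter fun f => f a = o) (by simp)]
  congr 1
  · rw [pairSum, Finset.mul_sum]
    refine Finset.sum_congr ?_ ?_
    · ext f
      simp only [Finset.mem_filter, mem_partialInj, IsPartialInj, Finset.mem_insert, not_or]
      constructor
      · rintro ⟨⟨h1, h2⟩, h3⟩
        refine ⟨fun i hi => ?_, h2⟩
        by_cases h : i = a
        · exact h ▸ h3
        · exact h1 i ⟨h, hi⟩
      · rintro ⟨h1, h2⟩
        exact ⟨⟨fun i hi => h1 i hi.2, h2⟩, h1 a ha⟩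
    · intro f hf
      rw [mem_partialInj] at hf
      simp [pairTerm, Finset.prod_insert ha, hf.1 a ha, mul_assoc]
  · refine Finset.sum_congr rfl fun j hj => ?_
    rw [pairSum, Finset.mul_sum]
    refine (Finset.sum_bij' (fun f _ => Function.update f a (some j))
      (fun f _ => Function.update f a none) ?_ ?_ ?_ ?_ ?_).symm
    · intro f hf
      simp only [Finset.mem_filter]
      exact ⟨update_mem_partialInj ha hj hf, by simp⟩
    · intro f hf
      rw [Finset.mem_filter] at hf
      exact update_none_mem_partialInj hf.1 hf.2
    · intro f hf
      rw [mem_partialInj] at hf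
      simp [← hf.1 a ha]
    · intro f hf
      rw [Finset.mem_filter] at hf
      simp [← hf.2]
    · intro f hf
      rw [mem_partialInj] at hf
      rw [pairTerm, pairTerm, Finset.prod_insert ha, Function.update_self, Option.elim_some,
        mul_assoc]
      congr 2
      · refine Finset.prod_congr rfl fun i hi => ?_
        rw [Function.update_of_ne (by rintro rfl; exact ha hi)]
      · refine Finset.prod_congr ?_ fun _ _ => rfl
        ext k
        simp only [Finset.mem_filter, Finset.mem_erase]
        constructor
        · rintro ⟨⟨h1, h2⟩, h3⟩
          refine ⟨h2, fun i => ?_⟩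
          by_cases h : i = a
          · subst h
            simpa using Ne.symm h1
          · rw [Function.update_of_ne h]
            exact h3 i
        · rintro ⟨h2, h3⟩
          refine ⟨⟨?_, h2⟩, fun i => ?_⟩
          · rintro rfl
            exact h3 a (by simp)
          · by_cases h : i = a
            · subst h
              simp [hf.1 i ha]
            · simpa [Function.update_of_ne h] using h3 i

theorem map_pairSum {S : Type*} [CommRing S] (φ : R →+* S) (c : ι → ι → R) (u v : ι → R)
    (A B : Finset ι) :
    φ (pairSum c u v A B) =
      pairSum (fun i j => φ (c i j)) (fun j => φ (u j)) (fun i => φ (v i)) A B := by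
  induction A using Finset.induction_on generalizing B with
  | empty => simp [pairSum_empty]
  | insert a A ha ih => simp [pairSum_insert _ _ _ ha, ih]

/-- The pairings between two groups of variables that are not linked to each other. -/
def blockDiag (c : ι → ι → R) (c' : κ → κ → R) : ι ⊕ κ → ι ⊕ κ → R
  | .inl i, .inl j => c i j
  | .inr i, .inr j => c' i j
  | _, _ => 0

/-- A pair across the two groups has coefficient zero, so a contributing pairing is a pair of
pairings, one in each group. -/
theorem pairSum_blockDiag (c : ι → ι → R) (c' : κ → κ → R) (u v : ι → R) (u' v' : κ → R)
    (A B : Finset ι) (A' B' : Finset κ) :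
    pairSum (blockDiag c c') (Sum.elim u u') (Sum.elim v v') (A.disjSum A') (B.disjSum B') =
      pairSum c u v A B * pairSum c' u' v' A' B' := by
  have hl (a : ι) (A : Finset ι) (A' : Finset κ) :
      (insert a A).disjSum A' = insert (Sum.inl a) (A.disjSum A') := by
    ext (x | x) <;> simp
  have hr (a : κ) (A : Finset ι) (A' : Finset κ) :
      A.disjSum (insert a A') = insert (Sum.inr a) (A.disjSum A') := by
    ext (x | x) <;> simp
  have el (a : ι) (A : Finset ι) (A' : Finset κ) :
      (A.disjSum A').erase (Sum.inl a) = (A.erase a).disjSum A' := by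
    ext (x | x) <;> simp
  have er (a : κ) (A : Finset ι) (A' : Finset κ) :
      (A.disjSum A').erase (Sum.inr a) = A.disjSum (A'.erase a) := by
    ext (x | x) <;> simp
  induction A using Finset.induction_on generalizing B with
  | empty =>
    induction A' using Finset.induction_on generalizing B' with
    | empty => simp [pairSum_empty, Finset.prod_disjSum]
    | insert a A' ha ih =>
      rw [hr, pairSum_insert _ _ _ (by simpa using ha), pairSum_insert _ _ _ ha,
        Finset.sum_disjSum]
      simp only [blockDiag, er, ih, Sum.elim_inr, zero_mul, Finset.sum_const_zero, zero_add,
        mul_add, Finset.mul_sum]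
      congr 1
      · ring
      · exact Finset.sum_congr rfl fun _ _ => by ring
  | insert a A ha ih =>
    rw [hl, pairSum_insert _ _ _ (by simpa using ha), pairSum_insert _ _ _ ha,
      Finset.sum_disjSum]
    simp only [blockDiag, el, ih, Sum.elim_inl, zero_mul, Finset.sum_const_zero, add_zero,
      add_mul, Finset.sum_mul, mul_assoc]

end PairSum

/-! ### Wirtinger derivatives and Wick's theorem. -/

section Wick

open MvPolynomial

variable {ι K : Type*} [DecidableEq ι]

theorem derivation_prod {S R : Type*} [CommRing S] [CommRing R] [Algebra S R]
    (δ : Derivation S R R) (u d : ι → R) (hu : ∀ j, δ (u j) = d j) (B : Finset ι) :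
    δ (∏ j ∈ B, u j) = ∑ j ∈ B, d j * ∏ k ∈ B.erase j, u k := by
  induction B using Finset.induction_on with
  | empty => simp
  | insert b B hb ih =>
    rw [Finset.prod_insert hb, Derivation.leibniz, ih, Finset.sum_insert hb, hu,
      Finset.erase_insert hb, add_comm, smul_eq_mul, smul_eq_mul, mul_comm, Finset.mul_sum]
    congr 1
    refine Finset.sum_congr rfl fun j hj => ?_
    have hne : b ≠ j := by
      rintro rfl
      exact hb hj
    rw [Finset.erase_insert_of_ne hne, Finset.prod_insert (by simp [hb])]
    ring

variable [Fintype ι]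

/-- Only the unpaired factors `u j` are affected: the Leibniz rule picks one of them, and what
remains is the sum over pairings that avoid this `j`. -/
theorem derivation_pairSum {S R : Type*} [CommRing S] [CommRing R] [Algebra S R]
    (δ : Derivation S R R) (c : ι → ι → R) (u v d : ι → R) (hu : ∀ j, δ (u j) = d j)
    (hv : ∀ i, δ (v i) = 0) (hc : ∀ i j, δ (c i j) = 0) (A B : Finset ι) :
    δ (pairSum c u v A B) = ∑ j ∈ B, d j * pairSum c u v A (B.erase j) := by
  induction A using Finset.induction_on generalizing B with
  | empty => simp only [pairSum_empty, derivation_prod δ u d hu]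
  | insert a A ha ih =>
    simp only [pairSum_insert _ _ _ ha, map_add, map_sum, Derivation.leibniz, hv, hc, smul_eq_mul,
      mul_zero, add_zero, ih, mul_add, Finset.mul_sum, Finset.sum_add_distrib]
    congr 1
    · exact Finset.sum_congr rfl fun _ _ => by ring
    · rw [Finset.sum_comm' (t' := B) (s' := fun j => B.erase j)
        (by intro x y; simp only [Finset.mem_erase]; tauto)]
      refine Finset.sum_congr rfl fun j _ => Finset.sum_congr rfl fun k _ => ?_
      rw [Finset.erase_right_comm]
      ring

/-- The polynomial for the complex variable `k`, given by its real and imaginary parts. -/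
noncomputable def zPoly (k : K) : MvPolynomial (K × Bool) ℂ :=
  X (k, true) + C Complex.I * X (k, false)

/-- The polynomial for the conjugate of the complex variable `k`. -/
noncomputable def zbarPoly (k : K) : MvPolynomial (K × Bool) ℂ :=
  X (k, true) - C Complex.I * X (k, false)

/-- The Wirtinger derivative with respect to the complex variable `k`. -/
noncomputable def dz (k : K) :
    Derivation ℂ (MvPolynomial (K × Bool) ℂ) (MvPolynomial (K × Bool) ℂ) :=
  (2⁻¹ : ℂ) • (pderiv (k, true) - Complex.I • pderiv (k, false))

/-- The Wirtinger derivative with respect to the conjugate of the complex variable `k`. -/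
noncomputable def dzbar (k : K) :
    Derivation ℂ (MvPolynomial (K × Bool) ℂ) (MvPolynomial (K × Bool) ℂ) :=
  (2⁻¹ : ℂ) • (pderiv (k, true) + Complex.I • pderiv (k, false))

theorem dz_zPoly [DecidableEq K] (k l : K) : dz k (zPoly l) = C (if k = l then 1 else 0) := by
  by_cases h : k = l
  · subst h
    simp [dz, zPoly, pderiv_X, smul_eq_C_mul, ← C_mul]
    rw [← C_add]
    norm_num
  · simp [dz, zPoly, pderiv_X, h, Ne.symm h]

theorem dz_zbarPoly (k l : K) : dz k (zbarPoly l) = 0 := by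
  classical
  by_cases h : k = l
  · subst h
    simp [dz, zbarPoly, pderiv_X, smul_eq_C_mul, ← C_mul]
  · simp [dz, zbarPoly, pderiv_X, Ne.symm h]

theorem dzbar_zPoly (k l : K) : dzbar k (zPoly l) = 0 := by
  classical
  by_cases h : k = l
  · subst h
    simp [dzbar, zPoly, pderiv_X, smul_eq_C_mul, ← C_mul]
  · simp [dzbar, zPoly, pderiv_X, Ne.symm h]

variable {Ω : Type*} [MeasurableSpace Ω] {μ : Measure Ω} [IsProbabilityMeasure μ]
  [Fintype K] {x : K × Bool → Ω → ℝ}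

/-- The variance `1 / 2` of the real and imaginary parts is exactly the factor `1 / 2` in the
Wirtinger derivative. -/
theorem integral_zbarPoly_mul (hx : ∀ t, HasLaw (x t) (gaussianReal 0 (1 / 2)) μ)
    (hi : iIndepFun x μ) (k : K) (P : MvPolynomial (K × Bool) ℂ) :
    ∫ ω, eval (fun t => (x t ω : ℂ)) (zbarPoly k * P) ∂μ =
      ∫ ω, eval (fun t => (x t ω : ℂ)) (dz k P) ∂μ := by
  have e1 : zbarPoly k * P = X (k, true) * P - C Complex.I * (X (k, false) * P) := by
    rw [zbarPoly]; ring
  have e2 : dz k P = C 2⁻¹ * pderiv (k, true) P - C (2⁻¹ * Complex.I) * pderiv (k, false) P := by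
    simp [dz, smul_eq_C_mul, mul_sub, mul_assoc]
  have hI := integrable_eval_gaussian hx
  rw [e1, e2]
  simp only [map_sub]
  rw [integral_sub (hI _) (hI _), integral_sub (hI _) (hI _)]
  simp only [map_mul (eval _) (C _), eval_C, integral_const_mul]
  rw [integral_X_mul_gaussian hx (by simp) hi, integral_X_mul_gaussian hx (by simp) hi]
  push_cast
  ring

theorem integral_zPoly_mul (hx : ∀ t, HasLaw (x t) (gaussianReal 0 (1 / 2)) μ)
    (hi : iIndepFun x μ) (k : K) (P : MvPolynomial (K × Bool) ℂ) :
    ∫ ω, eval (fun t => (x t ω : ℂ)) (zPoly k * P) ∂μ =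
      ∫ ω, eval (fun t => (x t ω : ℂ)) (dzbar k P) ∂μ := by
  have e1 : zPoly k * P = X (k, true) * P + C Complex.I * (X (k, false) * P) := by
    rw [zPoly]; ring
  have e2 : dzbar k P =
      C 2⁻¹ * pderiv (k, true) P + C (2⁻¹ * Complex.I) * pderiv (k, false) P := by
    simp [dzbar, smul_eq_C_mul, mul_assoc]
  have hI := integrable_eval_gaussian hx
  rw [e1, e2]
  simp only [map_add]
  rw [integral_add (hI _) (hI _), integral_add (hI _) (hI _)]
  simp only [map_mul (eval _) (C _), eval_C, integral_const_mul]
  rw [integral_X_mul_gaussian hx (by simp) hi, integral_X_mul_gaussian hx (by simp) hi]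
  push_cast
  ring

/-- Wick's theorem, with noncentral variables and with some pairings performed beforehand. -/
theorem integral_pairSum [DecidableEq K] (hx : ∀ t, HasLaw (x t) (gaussianReal 0 (1 / 2)) μ)
    (hi : iIndepFun x μ) (o e : ι → K) (u v : ι → ℂ) (c : ι → ι → ℂ) (A B : Finset ι) :
    ∫ ω, eval (fun t => (x t ω : ℂ)) (pairSum (fun i j => C (c i j))
      (fun j => C (u j) + zPoly (o j)) (fun i => C (v i) + zbarPoly (e i)) A B) ∂μ =
    pairSum (fun i j => c i j + if e i = o j then 1 else 0) u v A B := by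
  have hI := integrable_eval_gaussian hx
  induction A using Finset.induction_on generalizing B with
  | empty =>
    simp only [pairSum_empty]
    induction B using Finset.induction_on with
    | empty => simp
    | insert b B hb ih =>
      -- With no conjugate variable left the product is holomorphic, so the expectation sees only
      -- the constants `u j`.
      have h0 : dzbar (o b) (∏ j ∈ B, (C (u j) + zPoly (o j))) = 0 := by
        rw [derivation_prod _ _ (fun _ => 0) (fun j => by
          simp [dzbar_zPoly, MvPolynomial.derivation_C])]
        simp
      rw [Finset.prod_insert hb, Finset.prod_insert hb, add_mul]
      simp only [map_add]
      rw [integral_add (hI _) (hI _), integral_zPoly_mul hx hi, h0]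
      simp only [map_mul (eval _) (C _), eval_C, integral_const_mul, ih]
      simp
  | insert a A ha ih =>
    have hadd (P Q : MvPolynomial (K × Bool) ℂ) :
        ∫ ω, eval (fun t => (x t ω : ℂ)) (P + Q) ∂μ =
          ∫ ω, eval (fun t => (x t ω : ℂ)) P ∂μ + ∫ ω, eval (fun t => (x t ω : ℂ)) Q ∂μ := by
      simp only [map_add]
      exact integral_add (hI _) (hI _)
    have hsum (P : ι → MvPolynomial (K × Bool) ℂ) :
        ∫ ω, eval (fun t => (x t ω : ℂ)) (∑ j ∈ B, P j) ∂μ =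
          ∑ j ∈ B, ∫ ω, eval (fun t => (x t ω : ℂ)) (P j) ∂μ := by
      simp only [map_sum]
      exact integral_finsetSum _ fun j _ => hI _
    -- Integrating by parts in the conjugate variable of `a` pairs it with each available `j` having
    -- the same entry; this adds the delta to the coefficient `c a j`.
    rw [pairSum_insert _ _ _ ha, pairSum_insert _ _ _ ha, add_mul, hadd, hadd, hsum,
      integral_zbarPoly_mul hx hi,
      derivation_pairSum _ _ _ _ (fun j => C (if e a = o j then 1 else 0))
        (fun j => by simp [dz_zPoly, MvPolynomial.derivation_C])
        (fun i => by simp [dz_zbarPoly, MvPolynomial.derivation_C])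
        (fun i j => by simp [MvPolynomial.derivation_C]), hsum]
    simp only [map_mul (eval _) (C _), eval_C, integral_const_mul, ih, add_mul,
      Finset.sum_add_distrib]
    ring

end Wick

/-! ### Paths and cycles of a partial permutation, and labellings constant on them. -/

section Classes

variable {ι : Type*}

/-- The partition of `ι` into the paths and cycles of a partial permutation. -/
def stepSetoid (q : ι ≃. ι) : Setoid ι := Relation.EqvGen.setoid fun i j => j ∈ q i

/-- The elements outside the range of a partial permutation. -/
abbrev Starts (q : ι ≃. ι) : Type _ := {j : ι // q.symm j = none}

theorem stepSetoid_of_mem {q : ι ≃. ι} {i j : ι} (h : j ∈ q i) : stepSetoid q i j :=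
  Relation.EqvGen.rel _ _ h

theorem stepSetoid_symm (q : ι ≃. ι) : stepSetoid q.symm = stepSetoid q := by
  refine le_antisymm (Setoid.eqvGen_le fun i j h => ?_) (Setoid.eqvGen_le fun i j h => ?_)
  · exact (stepSetoid q).symm' (stepSetoid_of_mem (q.mem_iff_mem.1 h))
  · exact (stepSetoid q.symm).symm' (stepSetoid_of_mem (q.mem_iff_mem.2 h))

/-- Since `q` is single-valued and `e` has no successor, whether `e` can be reached is the same for
both ends of a step, hence constant on a class. So a class contains at most one end. -/
theorem eq_of_stepSetoid {q : ι ≃. ι} {e e' : ι} (he : q e = none) (he' : q e' = none)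
    (h : stepSetoid q e e') : e = e' := by
  have key : ∀ x y, Relation.EqvGen (fun i j => j ∈ q i) x y →
      (Relation.ReflTransGen (fun i j => j ∈ q i) x e ↔
        Relation.ReflTransGen (fun i j => j ∈ q i) y e) := by
    intro x y hxy
    induction hxy with
    | rel x y hxy =>
      constructor
      · intro hx
        rcases hx.cases_head with rfl | ⟨z, hz, hze⟩
        · simp [he] at hxy
        · rwa [Option.mem_unique hxy hz]
      · exact fun hy => hy.head hxy
    | refl x => rfl
    | symm x y _ ih => exact ih.symm
    | trans x y z _ _ ih1 ih2 => exact ih1.trans ih2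
  rcases ((key e e' h).1 .refl).cases_head with h1 | ⟨z, hz, -⟩
  · exact h1.symm
  · simp [he'] at hz

theorem eq_of_stepSetoid_of_compatible {α : Type*} {q : ι ≃. ι} {g : ι → α}
    (hg : ∀ i, ∀ j ∈ q i, g i = g j) {i j : ι} (h : stepSetoid q i j) : g i = g j :=
  Setoid.eqvGen_le (s := Setoid.ker g) (fun i j hij => hg i j hij) h

/-- Without an end, `q` would be an injective self-map of the finite class of `j`, hence surjective,
and would hit `j`, which has no predecessor. -/
theorem exists_end [Finite ι] {q : ι ≃. ι} {j : ι} (hj : q.symm j = none) :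
    ∃ e, q e = none ∧ stepSetoid q j e := by
  by_contra! hcon
  have hs : ∀ i : {i // stepSetoid q j i}, (q i).isSome := fun i => by
    rw [Option.isSome_iff_ne_none]
    exact fun h => hcon i h i.2
  let f : {i // stepSetoid q j i} → {i // stepSetoid q j i} := fun i =>
    ⟨(q i).get (hs i), (stepSetoid q).trans' i.2 (stepSetoid_of_mem (Option.get_mem _))⟩
  have hf : Function.Injective f := fun a b hab => by
    have h1 : (q a).get (hs a) = (q b).get (hs b) := congrArg Subtype.val hab
    have h2 : (q a).get (hs a) ∈ q b := by
      rw [h1]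
      exact Option.get_mem _
    exact Subtype.ext (q.inj (Option.get_mem (hs a)) h2)
  obtain ⟨i, hi⟩ := (Finite.injective_iff_surjective.1 hf) ⟨j, (stepSetoid q).refl' j⟩
  have h1 : (q i).get (hs i) = j := congrArg Subtype.val hi
  have h2 : (q i).get (hs i) ∈ q i := Option.get_mem (hs i)
  rw [h1, ← q.mem_iff_mem, hj] at h2
  simp at h2

/-- Following the paths of a partial permutation from their starts to their ends. -/
theorem exists_startsEquiv [Finite ι] (q : ι ≃. ι) :
    ∃ θ : Starts q ≃ Starts q.symm, ∀ j : Starts q, stepSetoid q (j : ι) (θ j : ι) := by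
  choose f hf1 hf2 using fun j : Starts q => exists_end j.2
  let F : Starts q → Starts q.symm := fun j => ⟨f j, hf1 j⟩
  have hinj : Function.Injective F := fun a b hab => by
    have h1 : f a = f b := congrArg Subtype.val hab
    have h2 : stepSetoid q a b := (stepSetoid q).trans' (hf2 a)
      ((stepSetoid q).symm' (h1 ▸ hf2 b))
    rw [← stepSetoid_symm] at h2
    exact Subtype.ext (eq_of_stepSetoid a.2 b.2 h2)
  have hsurj : Function.Surjective F := fun e => by
    obtain ⟨j, hj, hs⟩ := exists_end (q := q.symm) e.2
    rw [stepSetoid_symm] at hs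
    refine ⟨⟨j, hj⟩, Subtype.ext ?_⟩
    exact eq_of_stepSetoid (hf1 _) e.2 ((stepSetoid q).symm'
      ((stepSetoid q).trans' hs (hf2 ⟨j, hj⟩)))
  exact ⟨Equiv.ofBijective F ⟨hinj, hsurj⟩, hf2⟩

/-- The classes of a partial permutation that are cycles. -/
abbrev Loops (q : ι ≃. ι) : Type _ :=
  {c : Quotient (stepSetoid q) // ¬ ∃ j : Starts q, (Quotient.mk _ (j : ι)) = c}

/-- A compatible labelling is a function on classes. A path is recorded by its unique start, whereas
the label of a cycle is invisible to `H` and contributes a free factor. -/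
theorem sum_compatible [Fintype ι] [DecidableEq ι] {α R : Type*} [Fintype α] [CommRing R]
    (q : ι ≃. ι) [DecidablePred fun g : ι → α => ∀ i, ∀ j ∈ q i, g i = g j]
    (H : (Starts q → α) → R) :
    ∑ g : ι → α with ∀ i, ∀ j ∈ q i, g i = g j, H (fun j => g j) =
      (Fintype.card α : R) ^ Nat.card (Loops q) * ∑ G : Starts q → α, H G := by
  classical
  let p : Quotient (stepSetoid q) → Prop :=
    fun c => ∃ j : Starts q, (Quotient.mk _ (j : ι)) = c
  have h1 : ∑ g : ι → α with ∀ i, ∀ j ∈ q i, g i = g j, H (fun j => g j) =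
      ∑ h : Quotient (stepSetoid q) → α, H (fun j => h (Quotient.mk _ (j : ι))) := by
    refine (Finset.sum_bij (fun h _ i => h (Quotient.mk _ i)) ?_ ?_ ?_ ?_).symm
    · intro h _
      simp only [Finset.mem_filter, Finset.mem_univ, true_and]
      exact fun i j hij => congrArg h (Quotient.sound (stepSetoid_of_mem hij))
    · intro h _ h' _ hh
      funext c
      induction c using Quotient.inductionOn with
      | _ i => exact congrFun hh i
    · intro g hg
      simp only [Finset.mem_filter, Finset.mem_univ, true_and] at hg
      refine ⟨Quotient.lift g fun a b hab => ?_, Finset.mem_univ _, rfl⟩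
      exact Setoid.eqvGen_le (s := Setoid.ker g) (fun i j hij => hg i j hij) hab
    · intros
      rfl
  let e : Starts q ≃ {c // p c} := Equiv.ofBijective (fun j => ⟨Quotient.mk _ (j : ι), j, rfl⟩)
    ⟨fun a b hab => by
      have h2 : stepSetoid q a b := Quotient.exact (congrArg Subtype.val hab)
      rw [← stepSetoid_symm] at h2
      exact Subtype.ext (eq_of_stepSetoid a.2 b.2 h2),
    fun ⟨c, j, hj⟩ => ⟨j, Subtype.ext hj⟩⟩
  let E : (Quotient (stepSetoid q) → α) ≃ (Starts q → α) × ({c // ¬ p c} → α) :=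
    (Equiv.piEquivPiSubtypeProd p fun _ => α).trans
      ((e.symm.arrowCongr (Equiv.refl α)).prodCongr (Equiv.refl _))
  have h3 : ∑ h : Quotient (stepSetoid q) → α, H (fun j => h (Quotient.mk _ (j : ι))) =
      ∑ x : (Starts q → α) × ({c // ¬ p c} → α), H x.1 :=
    Fintype.sum_equiv E _ _ fun h => rfl
  rw [h1, h3, Fintype.sum_prod_type]
  simp only [Finset.sum_const, Finset.card_univ, Fintype.card_fun, nsmul_eq_mul,
    ← Finset.mul_sum, Nat.card_eq_fintype_card]
  push_cast
  rfl

end Classes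

/-! ### Sums over cyclic labellings as traces of powers. -/

section Cycles

variable {α R : Type*} [Fintype α] [DecidableEq α] [CommRing R]

/-- The arbitrary weight `w` of the two end labels makes the induction work: the first edge is
absorbed into it. -/
theorem sum_path (B : Matrix α α R) (m : ℕ) (w : α → α → R) :
    ∑ F : Fin (m + 1) → α, w (F 0) (F (Fin.last m)) * ∏ i : Fin m, B (F i.castSucc) (F i.succ) =
      ∑ a, ∑ b, w a b * (B ^ m) a b := by
  induction m generalizing w with
  | zero =>
    rw [Fintype.sum_equiv (Equiv.funUnique (Fin 1) α) _ (fun a => w a a) (by simp)]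
    simp [Matrix.one_apply]
  | succ m ih =>
    rw [← (Fin.consEquiv (fun _ => α)).sum_comp, Fintype.sum_prod_type]
    refine Finset.sum_congr rfl fun x _ => ?_
    have := ih fun a b => w x b * B x a
    simp only [Fin.consEquiv_apply, Fin.cons_zero, Fin.prod_univ_succ, Fin.castSucc_zero,
      Fin.cons_succ, ← Fin.succ_last, ← Fin.succ_castSucc]
    simp only [← mul_assoc]
    rw [this, Finset.sum_comm]
    refine Finset.sum_congr rfl fun b _ => ?_
    rw [pow_succ', Matrix.mul_apply, Finset.mul_sum]
    exact Finset.sum_congr rfl fun a _ => by ring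

theorem sum_cycle (B : Matrix α α R) (m : ℕ) [NeZero m] :
    ∑ F : ZMod m → α, ∏ i, B (F i) (F (i + 1)) = (B ^ m).trace := by
  obtain ⟨k, rfl⟩ := Nat.exists_eq_succ_of_ne_zero (NeZero.ne m)
  -- This weight is the edge that closes the path to a cycle.
  have h := sum_path B k fun a b => B b a
  have h2 (F : Fin (k + 1) → α) : ∏ i, B (F i) (F (i + 1)) =
      B (F (Fin.last k)) (F 0) * ∏ i : Fin k, B (F i.castSucc) (F i.succ) := by
    rw [Fin.prod_univ_castSucc, mul_comm, Fin.last_add_one]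
    simp
  change ∑ F : Fin (k + 1) → α, ∏ i, B (F i) (F (i + 1)) = _
  simp only [h2, h]
  rw [Finset.sum_comm, Nat.succ_eq_add_one, pow_succ', Matrix.trace]
  simp [Matrix.mul_apply]

/-- The orbit map identifies `J` with `ZMod m` so that `τ` becomes the shift by one. -/
theorem sum_single_cycle {J : Type*} [Fintype J] [DecidableEq J] (B : Matrix α α R) (τ : Equiv.Perm J) (j₀ : J)
    (h : ∀ j, τ.SameCycle j₀ j) :
    ∑ F : J → α, ∏ j, B (F j) (F (τ j)) = (B ^ Fintype.card J).trace := by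
  let m := Function.minimalPeriod (τ • ·) j₀
  have hm : NeZero m := ⟨(Function.minimalPeriod_pos_of_mem_periodicPts
    (Function.Injective.mem_periodicPts (MulAction.injective τ) j₀)).ne'⟩
  have horb (j : J) : j ∈ MulAction.orbit (Subgroup.zpowers τ) j₀ := by
    obtain ⟨k, hk⟩ := h j
    exact ⟨⟨τ ^ k, k, rfl⟩, hk⟩
  let e : ZMod m ≃ J := (MulAction.orbitZPowersEquiv τ j₀).symm.trans
    (Equiv.subtypeUnivEquiv horb)
  have he (k : ZMod m) : e (k + 1) = τ (e k) := by
    obtain ⟨k, rfl⟩ := ZMod.intCast_surjective k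
    have h1 (k : ℤ) : e k = (τ ^ k) j₀ := by
      simp only [e, Equiv.trans_apply]
      rw [MulAction.orbitZPowersEquiv_symm_apply']
      rfl
    have h2 := h1 (k + 1)
    push_cast at h2
    rw [h2, h1, add_comm, zpow_add, zpow_one]
    rfl
  rw [← Fintype.card_congr e, ZMod.card, ← sum_cycle]
  refine Fintype.sum_equiv (e.symm.arrowCongr (Equiv.refl α)) _ _ fun F => ?_
  refine Fintype.prod_equiv e.symm _ _ fun j => ?_
  simp [he]

/-- The sum over all labellings of a permutation is a product of traces, one for each cycle. -/
theorem sum_perm {J : Type*} [Fintype J] [DecidableEq J] (B : Matrix α α R) (τ : Equiv.Perm J)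
    (s : Setoid J) [DecidableRel s] (hs : ∀ i j, s i j ↔ τ.SameCycle i j) :
    ∑ F : J → α, ∏ j, B (F j) (F (τ j)) =
      ∏ b : Quotient s, (B ^ Fintype.card {j // Quotient.mk s j = b}).trace := by
  have hτ (b : Quotient s) (j : J) : Quotient.mk s (τ j) = b ↔ Quotient.mk s j = b := by
    have : Quotient.mk s (τ j) = Quotient.mk s j :=
      Quotient.sound ((hs _ _).2 (Equiv.Perm.SameCycle.refl τ j |>.apply_left))
    rw [this]
  have h1 (b : Quotient s) : (B ^ Fintype.card {j // Quotient.mk s j = b}).trace =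
      ∑ F : {j // Quotient.mk s j = b} → α,
        ∏ j, B (F j) (F (τ.subtypePerm (hτ b) j)) := by
    obtain ⟨j₀, hj₀⟩ := Quotient.exists_rep b
    refine (sum_single_cycle B _ ⟨j₀, hj₀⟩ fun j => ?_).symm
    rw [Equiv.Perm.sameCycle_subtypePerm, ← hs]
    exact Quotient.exact (hj₀.trans j.2.symm)
  simp only [h1]
  rw [Finset.prod_univ_sum, Fintype.piFinset_univ]
  refine Fintype.sum_equiv (((Equiv.sigmaFiberEquiv (Quotient.mk s)).symm.arrowCongr
    (Equiv.refl α)).trans (Equiv.piCurry fun _ _ => α)) _ _ fun F => ?_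
  rw [← (Equiv.sigmaFiberEquiv (Quotient.mk s)).prod_comp, Fintype.prod_sigma]
  rfl

end Cycles

/-! ### Vertex blocks: free labels are the cycles of the gluing. -/

section Blocks

variable {ι : Type*}

/-- The partial permutation by which the odd vertices are glued. -/
def oddStep (next : Equiv.Perm ι) (π : ι ≃. ι) : ι ≃. ι := next.symm.toPEquiv.trans π

theorem oddStep_apply (next : Equiv.Perm ι) (π : ι ≃. ι) (i : ι) :
    oddStep next π i = π (next.symm i) := rfl

theorem oddStep_symm_eq_none (next : Equiv.Perm ι) (π : ι ≃. ι) (j : ι) :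
    (oddStep next π).symm j = none ↔ π.symm j = none := by
  change (π.symm j).bind (fun i => some (next i)) = none ↔ _
  cases π.symm j <;> simp

theorem mem_rho₁ [Fintype ι] {π : ι ≃. ι} {i : ι} : i ∉ rho₁ π ↔ π i = none := by
  simp [rho₁]

theorem mem_rho₂ [Fintype ι] {π : ι ≃. ι} {j : ι} : j ∉ rho₂ π ↔ π.symm j = none := by
  simp [rho₂]

/-- The class of a vertex. -/
def vertexKey (next : Equiv.Perm ι) (π : ι ≃. ι) :
    Vertex ι → Quotient (stepSetoid (oddStep next π)) ⊕ Quotient (stepSetoid π)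
  | .odd i => .inl (Quotient.mk _ i)
  | .even i => .inr (Quotient.mk _ i)

theorem vertexKey_eq {next : Equiv.Perm ι} {π : ι ≃. ι} {v w : Vertex ι}
    (h : vertexSetoid next π v w) : vertexKey next π v = vertexKey next π w := by
  refine Setoid.eqvGen_le (s := Setoid.ker (vertexKey next π)) ?_ h
  rintro v w ⟨i, j, hij, ⟨rfl, rfl⟩ | ⟨rfl, rfl⟩⟩
  · exact congrArg Sum.inr (Quotient.sound (stepSetoid_of_mem hij))
  · refine congrArg Sum.inl (Quotient.sound (stepSetoid_of_mem ?_))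
    rwa [oddStep_apply, Equiv.symm_apply_apply]

theorem vertexSetoid_even_iff {next : Equiv.Perm ι} {π : ι ≃. ι} {i : ι} {v : Vertex ι} :
    vertexSetoid next π (.even i) v ↔ ∃ j, v = .even j ∧ stepSetoid π i j := by
  constructor
  · intro h
    have h1 := vertexKey_eq h
    cases v with
    | odd j => simp [vertexKey] at h1
    | even j => exact ⟨j, rfl, Quotient.exact (Sum.inr_injective h1)⟩
  · rintro ⟨j, rfl, h⟩
    exact Setoid.eqvGen_le (s := (vertexSetoid next π).comap Vertex.even)
      (fun i j hij => Relation.EqvGen.rel _ _ ⟨i, j, hij, .inl ⟨rfl, rfl⟩⟩) h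

theorem vertexSetoid_odd_iff {next : Equiv.Perm ι} {π : ι ≃. ι} {i : ι} {v : Vertex ι} :
    vertexSetoid next π (.odd i) v ↔ ∃ j, v = .odd j ∧ stepSetoid (oddStep next π) i j := by
  constructor
  · intro h
    have h1 := vertexKey_eq h
    cases v with
    | odd j => exact ⟨j, rfl, Quotient.exact (Sum.inl_injective h1)⟩
    | even j => simp [vertexKey] at h1
  · rintro ⟨j, rfl, h⟩
    refine Setoid.eqvGen_le (s := (vertexSetoid next π).comap Vertex.odd)
      (fun i j hij => Relation.EqvGen.rel _ _ ⟨next.symm i, j, hij, .inr ⟨?_, rfl⟩⟩) h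
    simp [Edge.target]

variable [Fintype ι]

/-- This treats even and odd blocks together. A block borders to a deterministic edge exactly when
its class has a start, so the blocks that do not are the cycles. -/
theorem ncard_blocks {next : Equiv.Perm ι} {π : ι ≃. ι} (q : ι ≃. ι)
    (V : ι → Vertex ι) (P : VertexBlock next π → Prop)
    (hP : ∀ c, P c ↔ ∃ i, Quotient.mk _ (V i) = c)
    (hV : ∀ i j, vertexSetoid next π (V i) (V j) ↔ stepSetoid q i j)
    (hB : ∀ i, BordersDet next π (Quotient.mk _ (V i)) ↔ ∃ j : Starts q, stepSetoid q j i) :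
    {c | P c}.ncard = {c | P c ∧ BordersDet next π c}.ncard + Nat.card (Loops q) := by
  classical
  let φ : Quotient (stepSetoid q) → VertexBlock next π :=
    Quotient.map V fun i j hij => (hV i j).2 hij
  have hφ : Function.Injective φ := by
    intro a b
    induction a using Quotient.inductionOn with
    | _ a =>
      induction b using Quotient.inductionOn with
      | _ b => exact fun h => Quotient.sound ((hV a b).1 (Quotient.exact h))
  have h1 : {c | P c ∧ ¬ BordersDet next π c} =
      φ '' {c | ¬ ∃ j : Starts q, (Quotient.mk _ (j : ι)) = c} := by
    ext c
    simp only [Set.mem_ofPred_eq, Set.mem_image]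
    constructor
    · rintro ⟨hc, hd⟩
      obtain ⟨i, rfl⟩ := (hP c).1 hc
      refine ⟨Quotient.mk _ i, ?_, rfl⟩
      rintro ⟨j, hj⟩
      exact hd ((hB i).2 ⟨j, Quotient.exact hj⟩)
    · rintro ⟨c, hc, rfl⟩
      obtain ⟨i, rfl⟩ := Quotient.exists_rep c
      refine ⟨(hP _).2 ⟨i, rfl⟩, fun hd => hc ?_⟩
      obtain ⟨j, hj⟩ := (hB i).1 hd
      exact ⟨j, Quotient.sound hj⟩
  have h2 : Nat.card (Loops q) = {c | P c ∧ ¬ BordersDet next π c}.ncard := by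
    rw [h1, Set.ncard_image_of_injective _ hφ]
    rfl
  rw [h2, ← Set.ncard_union_eq]
  · congr 1
    ext c
    simp only [Set.mem_ofPred_eq, Set.mem_union]
    tauto
  · rw [Set.disjoint_left]
    rintro c ⟨-, hc⟩ ⟨-, hc'⟩
    exact hc' hc

theorem kBlocks_eq (next : Equiv.Perm ι) (π : ι ≃. ι) :
    kBlocks next π = kdBlocks next π + Nat.card (Loops π) := by
  refine ncard_blocks π Vertex.even (IsEvenBlock next π) (fun c => ?_) (fun i j => ?_)
    (fun i => ?_)
  · obtain ⟨v, rfl⟩ := Quotient.exists_rep c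
    constructor
    · intro h
      cases v with
      | odd i => exact (h _ rfl).elim
      | even i => exact ⟨i, rfl⟩
    · rintro ⟨i, hi⟩ w hw
      obtain ⟨j, rfl, -⟩ := vertexSetoid_even_iff.1 (Quotient.exact (hi.trans hw.symm))
      trivial
  · rw [vertexSetoid_even_iff]
    simp
  · constructor
    · rintro ⟨v, ⟨e, he⟩, hv, hb⟩
      obtain ⟨j, rfl, hj⟩ := vertexSetoid_even_iff.1 (Quotient.exact hv.symm)
      cases e with
      | odd k =>
        obtain h | h := hb <;> simp [Edge.source, Edge.target] at h
        subst h
        exact ⟨⟨j, mem_rho₂.1 he⟩, (stepSetoid π).symm' hj⟩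
      | even k =>
        obtain h | h := hb <;> simp [Edge.source, Edge.target] at h
        subst h
        -- An even deterministic edge sits at the end of a path; walking backwards leads to its
        -- start.
        obtain ⟨e, he', hs⟩ := exists_end (q := π.symm) (j := j) (mem_rho₁.1 he)
        rw [stepSetoid_symm] at hs
        exact ⟨⟨e, he'⟩, (stepSetoid π).symm' ((stepSetoid π).trans' hj hs)⟩
    · rintro ⟨j, hj⟩
      exact ⟨.even j, ⟨.odd j, mem_rho₂.2 j.2⟩,
        Quotient.sound (vertexSetoid_even_iff.2 ⟨i, rfl, hj⟩), .inr rfl⟩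

theorem lBlocks_eq (next : Equiv.Perm ι) (π : ι ≃. ι) :
    lBlocks next π = ldBlocks next π + Nat.card (Loops (oddStep next π)) := by
  refine ncard_blocks (oddStep next π) Vertex.odd (IsOddBlock next π) (fun c => ?_)
    (fun i j => ?_) (fun i => ?_)
  · obtain ⟨v, rfl⟩ := Quotient.exists_rep c
    constructor
    · intro h
      cases v with
      | odd i => exact ⟨i, rfl⟩
      | even i => exact (h _ rfl trivial).elim
    · rintro ⟨i, hi⟩ w hw
      obtain ⟨j, rfl, -⟩ := vertexSetoid_odd_iff.1 (Quotient.exact (hi.trans hw.symm))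
      exact id
  · rw [vertexSetoid_odd_iff]
    simp
  · constructor
    · rintro ⟨v, ⟨e, he⟩, hv, hb⟩
      obtain ⟨j, rfl, hj⟩ := vertexSetoid_odd_iff.1 (Quotient.exact hv.symm)
      cases e with
      | odd k =>
        obtain h | h := hb <;> simp [Edge.source, Edge.target] at h
        subst h
        exact ⟨⟨j, (oddStep_symm_eq_none _ _ _).2 (mem_rho₂.1 he)⟩, Setoid.symm' _ hj⟩
      | even k =>
        obtain h | h := hb <;> simp [Edge.source, Edge.target] at h
        subst h
        have hk : oddStep next π (next k) = none := by
          rw [oddStep_apply, Equiv.symm_apply_apply]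
          exact mem_rho₁.1 he
        obtain ⟨e, he', hs⟩ := exists_end (q := (oddStep next π).symm) hk
        rw [stepSetoid_symm] at hs
        exact ⟨⟨e, he'⟩, Setoid.symm' _ (Setoid.trans' _ hj hs)⟩
    · rintro ⟨j, hj⟩
      exact ⟨.odd j, ⟨.odd j, mem_rho₂.2 ((oddStep_symm_eq_none _ _ _).1 j.2)⟩,
        Quotient.sound (vertexSetoid_odd_iff.2 ⟨i, rfl, hj⟩), .inl rfl⟩

theorem vertexFactor_eq (next : Equiv.Perm ι) (π : ι ≃. ι) (n N : ℕ) :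
    vertexFactor next π n N =
      (N : ℝ) ^ Nat.card (Loops π) * (n : ℝ) ^ Nat.card (Loops (oddStep next π)) := by
  rw [vertexFactor, kBlocks_eq, lBlocks_eq]
  simp

end Blocks

/-! ### Components of the deterministic edges as cycles of one permutation. -/

section EdgeBlocks

variable {ι : Type*} [Fintype ι] {next : Equiv.Perm ι} {π : ι ≃. ι}

/-- The odd deterministic edges. -/
def detOdd (π : ι ≃. ι) (j : Starts π) : DetEdge π := ⟨.odd j, mem_rho₂.2 j.2⟩

/-- The even deterministic edges. -/
def detEven (π : ι ≃. ι) (i : Starts π.symm) : DetEdge π := ⟨.even i, mem_rho₁.2 i.2⟩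

/-- `τ` sends an odd deterministic edge to the next one in its component; in between lies the even
deterministic edge given by `θ`. -/
structure IsContraction (next : Equiv.Perm ι) (π : ι ≃. ι) (θ : Starts π ≃ Starts π.symm)
    (τ : Equiv.Perm (Starts π)) : Prop where
  even : ∀ j : Starts π, stepSetoid π (j : ι) (θ j : ι)
  odd : ∀ j : Starts π, stepSetoid (oddStep next π) (τ j : ι) (next (θ j : ι))

theorem exists_isContraction (next : Equiv.Perm ι) (π : ι ≃. ι) :
    ∃ θ τ, IsContraction next π θ τ := by
  -- From an odd deterministic edge, the even vertex path leads to an even deterministic edge; the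
  -- odd vertex path, traversed backwards by `ψ.symm`, leads from there to the next odd one.
  obtain ⟨θ, hθ⟩ := exists_startsEquiv π
  obtain ⟨ψ, hψ⟩ := exists_startsEquiv (oddStep next π)
  let a : Starts (oddStep next π) ≃ Starts π :=
    Equiv.subtypeEquivRight fun j => oddStep_symm_eq_none next π j
  let b : Starts π.symm ≃ Starts (oddStep next π).symm := next.subtypeEquiv fun i => by
    change π i = none ↔ oddStep next π (next i) = none
    rw [oddStep_apply, Equiv.symm_apply_apply]
  refine ⟨θ, θ.trans (b.trans (ψ.symm.trans a)), hθ, fun j => ?_⟩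
  have := hψ (ψ.symm (b (θ j)))
  rw [Equiv.apply_symm_apply] at this
  exact this

namespace IsContraction

variable {θ : Starts π ≃ Starts π.symm} {τ : Equiv.Perm (Starts π)}

theorem detOdd_detEven (h : IsContraction next π θ τ) (j : Starts π) :
    edgeSetoid next π (detOdd π j) (detEven π (θ j)) :=
  Relation.EqvGen.rel _ _ ⟨.even j, .even (θ j), .inr rfl, .inl rfl,
    vertexSetoid_even_iff.2 ⟨_, rfl, h.even j⟩⟩

theorem detOdd_detOdd (h : IsContraction next π θ τ) (j : Starts π) :
    edgeSetoid next π (detOdd π (τ j)) (detOdd π j) :=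
  Setoid.trans' _ (Relation.EqvGen.rel _ _ ⟨.odd (τ j), .odd (next (θ j)), .inl rfl, .inr rfl,
    vertexSetoid_odd_iff.2 ⟨_, rfl, h.odd j⟩⟩) (Setoid.symm' _ (h.detOdd_detEven j))

theorem exists_detOdd (_ : IsContraction next π θ τ) (e : DetEdge π) :
    ∃ j, e = detOdd π j ∨ e = detEven π (θ j) := by
  obtain ⟨e, he⟩ := e
  cases e with
  | odd j => exact ⟨⟨j, mem_rho₂.1 he⟩, .inl rfl⟩
  | even i =>
    refine ⟨θ.symm ⟨i, mem_rho₁.1 he⟩, .inr ?_⟩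
    rw [Equiv.apply_symm_apply]
    rfl

/-- The odd deterministic edge of the component that precedes a given edge. -/
def base (θ : Starts π ≃ Starts π.symm) : DetEdge π → Starts π
  | ⟨.odd j, h⟩ => ⟨j, mem_rho₂.1 h⟩
  | ⟨.even i, h⟩ => θ.symm ⟨i, mem_rho₁.1 h⟩

theorem stepSetoid_base (h : IsContraction next π θ τ) {e : DetEdge π} {i : ι}
    (he : e.1.Borders next (.even i)) : stepSetoid π (base θ e : ι) i := by
  obtain ⟨e, hd⟩ := e
  cases e with
  | odd j =>
    obtain h1 | h1 := he <;> simp [Edge.source, Edge.target] at h1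
    subst h1
    exact Setoid.refl' _ _
  | even j =>
    obtain h1 | h1 := he <;> simp [Edge.source, Edge.target] at h1
    subst h1
    have := h.even (θ.symm ⟨i, mem_rho₁.1 hd⟩)
    rw [Equiv.apply_symm_apply] at this
    exact this

theorem exists_stepSetoid_base (h : IsContraction next π θ τ) {e : DetEdge π} {i : ι}
    (he : e.1.Borders next (.odd i)) :
    ∃ j : Starts π, stepSetoid (oddStep next π) (j : ι) i ∧ τ.SameCycle (base θ e) j := by
  obtain ⟨e, hd⟩ := e
  cases e with
  | odd j =>
    obtain h1 | h1 := he <;> simp [Edge.source, Edge.target] at h1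
    subst h1
    exact ⟨_, Setoid.refl' _ _, Equiv.Perm.SameCycle.refl _ _⟩
  | even j =>
    obtain h1 | h1 := he <;> simp [Edge.source, Edge.target] at h1
    subst h1
    have := h.odd (θ.symm ⟨j, mem_rho₁.1 hd⟩)
    rw [Equiv.apply_symm_apply] at this
    exact ⟨_, this, (Equiv.Perm.SameCycle.refl _ _).apply_right⟩

/-- A vertex class contains at most one start, so two deterministic edges meeting at a class have
the same base at an even class, and bases in the same cycle of `τ` at an odd one. -/
theorem sameCycle_of_edgeSetoid (h : IsContraction next π θ τ) {e f : DetEdge π}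
    (hef : edgeSetoid next π e f) : τ.SameCycle (base θ e) (base θ f) := by
  refine Setoid.eqvGen_le (s := (Equiv.Perm.SameCycle.setoid τ).comap (base θ)) ?_ hef
  rintro e f ⟨v, w, hv, hw, hvw⟩
  cases v with
  | even i =>
    obtain ⟨k, rfl, hk⟩ := vertexSetoid_even_iff.1 hvw
    have h1 : stepSetoid π (base θ e : ι) (base θ f : ι) := Setoid.trans' _ (h.stepSetoid_base hv)
      (Setoid.trans' _ hk (Setoid.symm' _ (h.stepSetoid_base hw)))
    rw [← stepSetoid_symm] at h1
    have h2 : base θ e = base θ f :=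
      Subtype.ext (eq_of_stepSetoid (base θ e).2 (base θ f).2 h1)
    change τ.SameCycle (base θ e) (base θ f)
    rw [h2]
  | odd i =>
    obtain ⟨k, rfl, hk⟩ := vertexSetoid_odd_iff.1 hvw
    obtain ⟨a, ha, ha'⟩ := h.exists_stepSetoid_base hv
    obtain ⟨b, hb, hb'⟩ := h.exists_stepSetoid_base hw
    have h1 : stepSetoid (oddStep next π) (a : ι) (b : ι) :=
      Setoid.trans' _ ha (Setoid.trans' _ hk (Setoid.symm' _ hb))
    rw [← stepSetoid_symm] at h1
    have h2 : a = b := Subtype.ext (eq_of_stepSetoid ((oddStep_symm_eq_none _ _ _).2 a.2)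
      ((oddStep_symm_eq_none _ _ _).2 b.2) h1)
    exact ha'.trans (h2 ▸ hb'.symm)

theorem edgeSetoid_detOdd_iff (h : IsContraction next π θ τ) (i j : Starts π) :
    edgeSetoid next π (detOdd π i) (detOdd π j) ↔ τ.SameCycle i j := by
  refine ⟨fun hij => h.sameCycle_of_edgeSetoid hij, fun ⟨k, hk⟩ => ?_⟩
  have h1 (k : ℕ) (i : Starts π) : edgeSetoid next π (detOdd π ((τ ^ k) i)) (detOdd π i) := by
    induction k with
    | zero => exact Setoid.refl' _ _
    | succ k ih =>
      rw [pow_succ']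
      exact Setoid.trans' _ (h.detOdd_detOdd _) ih
  subst hk
  obtain ⟨k, rfl | rfl⟩ := k.eq_nat_or_neg
  · exact Setoid.symm' _ (h1 k i)
  · have := h1 k ((τ ^ (-(k : ℤ))) i)
    rwa [← zpow_natCast, ← Equiv.Perm.mul_apply, ← zpow_add, add_neg_cancel, zpow_zero] at this

/-- The components of the deterministic edges, read off from the odd ones. -/
noncomputable def blockEquiv (h : IsContraction next π θ τ) :
    Quotient ((edgeSetoid next π).comap (detOdd π)) ≃ EdgeBlock next π :=
  Equiv.ofBijective (Quotient.map (detOdd π) fun _ _ h => h) <| by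
    constructor
    · intro a b
      induction a using Quotient.inductionOn with
      | _ a =>
        induction b using Quotient.inductionOn with
        | _ b =>
        exact fun h => Quotient.sound (s := (edgeSetoid next π).comap (detOdd π))
          (Quotient.exact (s := edgeSetoid next π) h)
    · intro b
      obtain ⟨e, rfl⟩ := Quotient.exists_rep b
      obtain ⟨j, rfl | rfl⟩ := h.exists_detOdd e
      · exact ⟨Quotient.mk _ j, rfl⟩
      · exact ⟨Quotient.mk _ j, Quotient.sound (h.detOdd_detEven j)⟩

/-- By `θ`, each component has as many even as odd deterministic edges. -/
theorem halfCard_eq (h : IsContraction next π θ τ)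
    (c : Quotient ((edgeSetoid next π).comap (detOdd π))) :
    halfCard next π (h.blockEquiv c) = Nat.card {j // Quotient.mk _ j = c} := by
  have hodd (j : Starts π) : (Quotient.mk _ (detOdd π j) : EdgeBlock next π) = h.blockEquiv c ↔
      Quotient.mk _ j = c :=
    h.blockEquiv.apply_eq_iff_eq (x := Quotient.mk _ j)
  have heven (j : Starts π) : (Quotient.mk _ (detEven π (θ j)) : EdgeBlock next π) =
      h.blockEquiv c ↔ Quotient.mk _ j = c := by
    rw [← hodd, Quotient.sound (h.detOdd_detEven j)]
  have h1 : {e : DetEdge π | (Quotient.mk _ e : EdgeBlock next π) = h.blockEquiv c} =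
      detOdd π '' {j | Quotient.mk _ j = c} ∪
        (detEven π ∘ θ) '' {j | Quotient.mk _ j = c} := by
    ext e
    constructor
    · intro he
      obtain ⟨j, rfl | rfl⟩ := h.exists_detOdd e
      · exact .inl ⟨j, (hodd j).1 he, rfl⟩
      · exact .inr ⟨j, (heven j).1 he, rfl⟩
    · rintro (⟨j, hj, rfl⟩ | ⟨j, hj, rfl⟩)
      · exact (hodd j).2 hj
      · exact (heven j).2 hj
  have h2 : Function.Injective (detOdd π) := fun a b hab => by
    simpa [detOdd, Subtype.ext_iff] using hab
  have h3 : Function.Injective (detEven π ∘ θ) := fun a b hab => by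
    have h4 : Edge.even (θ a : ι) = Edge.even (θ b : ι) := congrArg Subtype.val hab
    exact θ.injective (Subtype.ext (Edge.even.inj h4))
  rw [halfCard, h1, Set.ncard_union_eq, Set.ncard_image_of_injective _ h2,
    Set.ncard_image_of_injective _ h3, ← two_mul, Nat.mul_div_cancel_left _ two_pos]
  · rfl
  · rw [Set.disjoint_left]
    rintro e ⟨j, -, rfl⟩ ⟨j', -, h'⟩
    have h4 : Edge.even (θ j' : ι) = Edge.odd (j : ι) := congrArg Subtype.val h'
    cases h4

end IsContraction

variable {n N : ℕ}

theorem card_starts_add (π : ι ≃. ι) :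
    Fintype.card (Starts π) + (rho₁ π).card = Fintype.card ι := by
  obtain ⟨θ, -⟩ := exists_startsEquiv π
  rw [Fintype.card_congr θ, rho₁, Fintype.card_subtype, ← Finset.card_univ,
    ← Finset.card_filter_add_card_filter_not (s := Finset.univ) (fun i => π.symm.symm i = none)]
  congr 2
  ext i
  simp only [Finset.mem_filter, Finset.mem_univ, true_and]
  exact Option.isSome_iff_ne_none

/-- This is the total power of `1 / N` coming from the normalized moments. -/
theorem sum_halfCard (next : Equiv.Perm ι) (π : ι ≃. ι) :
    ∑ b : EdgeBlock next π, halfCard next π b = Fintype.card (Starts π) := by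
  classical
  obtain ⟨θ, τ, h⟩ := exists_isContraction next π
  rw [← h.blockEquiv.sum_comp, ← Fintype.card_congr (Equiv.sigmaFiberEquiv
    (Quotient.mk ((edgeSetoid next π).comap (detOdd π)))), Fintype.card_sigma]
  exact Finset.sum_congr rfl fun c _ => by rw [h.halfCard_eq, Nat.card_eq_fintype_card]

open scoped ComplexOrder in
theorem moment_nonneg (A : Matrix (Fin n) (Fin N) ℂ) (l : ℕ) : 0 ≤ moment A l := by
  have h1 : (((N : ℂ)⁻¹ • (A * Aᴴ)) ^ l).PosSemidef :=
    ((Matrix.posSemidef_self_mul_conjTranspose A).smul (by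
      rw [← Complex.ofReal_natCast, ← Complex.ofReal_inv]
      exact Complex.zero_le_real.2 (by positivity))).pow l
  have h2 := h1.trace_nonneg
  unfold moment
  rw [← Complex.ofReal_natCast, ← Complex.ofReal_inv, Complex.re_ofReal_mul]
  exact mul_nonneg (by positivity) (Complex.le_def.1 h2).1

theorem weight_mul_momentProd_nonneg (A : Matrix (Fin n) (Fin N) ℂ) (next : Equiv.Perm ι)
    (k : ℕ) (π : ι ≃. ι) : 0 ≤ weight next k n N π * momentProd A next π := by
  have h1 : 0 ≤ momentProd A next π := Finset.prod_nonneg fun b _ => moment_nonneg A _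
  have h2 : 0 ≤ weight next k n N π := by
    unfold weight vertexFactor
    positivity
  exact mul_nonneg h2 h1

end EdgeBlocks

/-! ### Terms of the estimator and of the variance as sums over labellings. -/

section GraphSum

variable {ι : Type*} [Fintype ι] [DecidableEq ι] {R : Type*} [CommRing R]

theorem pairSum_univ (c : ι → ι → R) (u v : ι → R) :
    pairSum c u v Finset.univ Finset.univ =
      ∑ π : ι ≃. ι, pairTerm c u v Finset.univ Finset.univ π := by
  classical
  refine (Finset.sum_bij (fun (π : ι ≃. ι) _ => (π : ι → Option ι)) ?_ ?_ ?_ ?_).symm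
  · intro π _
    rw [mem_partialInj]
    exact ⟨by simp, by simp, fun i i' j h h' => π.inj h h'⟩
  · intro π _ π' _ h
    exact DFunLike.coe_injective h
  · intro f hf
    rw [mem_partialInj] at hf
    have hinv (j i : ι) : (if h : ∃ i, j ∈ f i then some h.choose else none) = some i ↔
        f i = some j := by
      split_ifs with h
      · refine ⟨fun h1 => ?_, fun h1 => ?_⟩
        · rw [← Option.some_injective _ h1]
          exact h.choose_spec
        · exact congrArg some (hf.2.2 _ _ _ h.choose_spec h1)
      · exact ⟨fun h1 => by simp at h1, fun h1 => (h ⟨i, h1⟩).elim⟩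
    exact ⟨⟨f, fun j => if h : ∃ i, j ∈ f i then some h.choose else none,
      fun i j => hinv j i⟩, Finset.mem_univ _, rfl⟩
  · intros
    rfl

theorem pairTerm_univ (c : ι → ι → R) (u v : ι → R) (π : ι ≃. ι) :
    pairTerm c u v Finset.univ Finset.univ π =
      (∏ i, (π i).elim 1 (c i)) *
        ((∏ j : Starts π, u j) * ∏ i : Starts π.symm, v i) := by
  have h1 : ∏ i, (π i).elim (v i) (c i) =
      (∏ i, (π i).elim 1 (c i)) * ∏ i : Starts π.symm, v i := by
    rw [← Finset.prod_subtype (p := fun i => π.symm.symm i = none)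
      (Finset.univ.filter fun i => π i = none) (fun i => by simp [PEquiv.symm_symm]) v,
      Finset.prod_filter, ← Finset.prod_mul_distrib]
    refine Finset.prod_congr rfl fun i _ => ?_
    rcases π i with _ | j <;> simp
  have h2 : ∏ j with ∀ i, π i ≠ some j, u j = ∏ j : Starts π, u j := by
    refine Finset.prod_subtype _ (fun j => ?_) u
    simp only [Finset.mem_filter, Finset.mem_univ, true_and, Option.eq_none_iff_forall_ne_some]
    exact forall_congr' fun i => not_congr π.eq_some_iff.symm
  rw [pairTerm, h1, h2]
  ring

/-- With `s = -1` this produces the sign of the estimator. -/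
theorem pairTerm_const_mul (s : R) (c : ι → ι → R) (u v : ι → R) (π : ι ≃. ι) :
    pairTerm (fun i j => s * c i j) u v Finset.univ Finset.univ π =
      s ^ (rho₁ π).card * pairTerm c u v Finset.univ Finset.univ π := by
  have h : ∀ i, (π i).elim 1 (fun j => s * c i j) =
      (if (π i).isSome then s else 1) * (π i).elim 1 (c i) := fun i => by
    cases π i <;> simp
  rw [pairTerm_univ, pairTerm_univ]
  simp only [h]
  rw [Finset.prod_mul_distrib, Finset.prod_ite, Finset.prod_const, Finset.prod_const_one, rho₁]
  ring

theorem pairTerm_ite (Q : ι → ι → Prop) [∀ i j, Decidable (Q i j)] (c : ι → ι → R) (u v : ι → R) (π : ι ≃. ι) :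
    pairTerm (fun i j => if Q i j then c i j else 0) u v Finset.univ Finset.univ π =
      if ∀ i, ∀ j ∈ π i, Q i j then pairTerm c u v Finset.univ Finset.univ π else 0 := by
  rw [pairTerm_univ, pairTerm_univ]
  split_ifs with h
  · congr 1
    refine Finset.prod_congr rfl fun i _ => ?_
    rcases hi : π i with _ | j
    · rfl
    · simp [h i j hi]
  · push Not at h
    obtain ⟨i, j, hij, hQ⟩ := h
    rw [Finset.prod_eq_zero (Finset.mem_univ i), zero_mul]
    rw [Option.mem_def.1 hij]
    simp [hQ]

variable {n N : ℕ}

/-- The Kronecker delta of the entries at the even edge `i` and at the odd edge `j`. -/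
def edgeDelta (R : Type*) [CommRing R] (next : Equiv.Perm ι) (f : ι → Fin n) (g : ι → Fin N)
    (i j : ι) : R :=
  if (f (next i), g i) = (f j, g j) then 1 else 0

/-- The product of the entries of `A` at the deterministic edges for a labelling of the vertices,
provided that glued vertices have equal labels. -/
noncomputable def graphTerm (A : Matrix (Fin n) (Fin N) ℂ) (next : Equiv.Perm ι)
    (f : ι → Fin n) (g : ι → Fin N) (π : ι ≃. ι) : ℂ :=
  pairTerm (edgeDelta ℂ next f g) (fun j => A (f j) (g j)) (fun i => star (A (f (next i)) (g i)))
    Finset.univ Finset.univ π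

theorem graphTerm_eq (A : Matrix (Fin n) (Fin N) ℂ) (next : Equiv.Perm ι)
    (f : ι → Fin n) (g : ι → Fin N) (π : ι ≃. ι) :
    graphTerm A next f g π = if (∀ i, ∀ j ∈ oddStep next π i, f i = f j) ∧
      (∀ i, ∀ j ∈ π i, g i = g j) then (∏ j : Starts π, A (f j) (g j)) *
        ∏ i : Starts π.symm, star (A (f (next i)) (g i)) else 0 := by
  have h1 : (∀ i, ∀ j ∈ π i, (f (next i), g i) = (f j, g j)) ↔
      (∀ i, ∀ j ∈ oddStep next π i, f i = f j) ∧ (∀ i, ∀ j ∈ π i, g i = g j) := by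
    simp only [Prod.mk.injEq, oddStep_apply]
    constructor
    · intro h
      refine ⟨fun i j hj => ?_, fun i j hj => (h i j hj).2⟩
      simpa using (h _ j hj).1
    · exact fun h i j hj => ⟨h.1 (next i) j (by simpa using hj), h.2 i j hj⟩
  have h2 := pairTerm_ite (fun i j => (f (next i), g i) = (f j, g j)) (fun _ _ => (1 : ℂ))
    (fun j => A (f j) (g j)) (fun i => star (A (f (next i)) (g i))) π
  have h3 : ∏ i, (π i).elim (1 : ℂ) (fun _ => 1) = 1 :=
    Finset.prod_eq_one fun i _ => by cases π i <;> rfl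
  rw [pairTerm_univ (fun _ _ => (1 : ℂ)), h3, one_mul] at h2
  refine Eq.trans ?_ (h2.trans (if_congr h1 rfl rfl))
  rfl

/-- Cycles of the gluing give the vertex factor. On the starts, summing the column labels turns each
odd edge with its following even edge into an entry of `A * Aᴴ`; summing the row labels along the
cycles of `τ` gives the traces. -/
theorem sum_graphTerm (A : Matrix (Fin n) (Fin N) ℂ) (next : Equiv.Perm ι) (π : ι ≃. ι) :
    ∑ f : ι → Fin n, ∑ g : ι → Fin N, graphTerm A next f g π =
      (vertexFactor next π n N : ℂ) *
        ∏ b : EdgeBlock next π, ((A * Aᴴ) ^ halfCard next π b).trace := by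
  classical
  obtain ⟨θ, τ, h⟩ := exists_isContraction next π
  let a : Starts (oddStep next π) ≃ Starts π :=
    Equiv.subtypeEquivRight fun j => oddStep_symm_eq_none next π j
  let H : (Starts π → Fin n) → (Starts π → Fin N) → ℂ := fun F G =>
    ∏ j, A (F j) (G j) * star (A (F (τ j)) (G j))
  have h1 : ∑ f : ι → Fin n, ∑ g : ι → Fin N, graphTerm A next f g π =
      ∑ f : ι → Fin n with ∀ i, ∀ j ∈ oddStep next π i, f i = f j,
        ∑ g : ι → Fin N with ∀ i, ∀ j ∈ π i, g i = g j, H (fun j => f j) (fun j => g j) := by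
    rw [Finset.sum_filter]
    refine Finset.sum_congr rfl fun f _ => ?_
    split_ifs with hf
    · rw [Finset.sum_filter]
      refine Finset.sum_congr rfl fun g _ => ?_
      rw [graphTerm_eq]
      split_ifs with hfg hg hg
      · change _ = ∏ j : Starts π, A (f j) (g j) * star (A (f (τ j)) (g j))
        -- By compatibility, the even edge `θ j` has the column label of `j` and the row label of `τ
        -- j`.
        rw [Finset.prod_mul_distrib, ← θ.prod_comp]
        congr 1
        refine Finset.prod_congr rfl fun j _ => ?_
        rw [← eq_of_stepSetoid_of_compatible hf (h.odd j),
          ← eq_of_stepSetoid_of_compatible hg (h.even j)]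
      · exact (hg hfg.2).elim
      · exact (hfg ⟨hf, hg⟩).elim
      · rfl
    · refine Finset.sum_eq_zero fun g _ => ?_
      rw [graphTerm_eq, if_neg (fun h => hf h.1)]
  have h2 : ∑ F, ∑ G, H F G =
      ∏ b : EdgeBlock next π, ((A * Aᴴ) ^ halfCard next π b).trace := by
    have h3 (F : Starts π → Fin n) : ∑ G, H F G = ∏ j, (A * Aᴴ) (F j) (F (τ j)) := by
      simp only [Matrix.mul_apply, Matrix.conjTranspose_apply]
      rw [Finset.prod_univ_sum, Fintype.piFinset_univ]
    simp only [h3]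
    rw [sum_perm (A * Aᴴ) τ ((edgeSetoid next π).comap (detOdd π)) h.edgeSetoid_detOdd_iff]
    refine Fintype.prod_equiv h.blockEquiv _ _ fun b => ?_
    rw [h.halfCard_eq, Nat.card_eq_fintype_card]
  rw [h1]
  rw [Finset.sum_congr rfl fun f _ =>
    sum_compatible π fun G => H (fun j : Starts π => f j) G, ← Finset.mul_sum]
  have h4 := sum_compatible (oddStep next π) (fun F : Starts (oddStep next π) → Fin n =>
    ∑ G, H (fun j => F (a.symm j)) G)
  have h5 : ∑ F : Starts (oddStep next π) → Fin n, ∑ G, H (fun j => F (a.symm j)) G =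
      ∑ F, ∑ G, H F G :=
    Fintype.sum_equiv (a.arrowCongr (Equiv.refl (Fin n))) _ _ fun F => rfl
  rw [h5, h2] at h4
  refine (congrArg _ h4).trans ?_
  rw [vertexFactor_eq]
  push_cast
  rw [Fintype.card_fin, Fintype.card_fin]
  ring

/-- The terms of the estimator and of its variance as sums over labellings of the vertices. -/
theorem weight_mul_momentProd (hn : 1 ≤ n) (hN : 1 ≤ N) (A : Matrix (Fin n) (Fin N) ℂ)
    (next : Equiv.Perm ι) (k : ℕ) (π : ι ≃. ι) :
    ((weight next k n N π * momentProd A next π : ℝ) : ℂ) =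
      ((n : ℂ) ^ k * (N : ℂ) ^ Fintype.card ι)⁻¹ *
        ∑ f : ι → Fin n, ∑ g : ι → Fin N, graphTerm A next f g π := by
  have hn0 : (n : ℂ) ≠ 0 := by exact_mod_cast (by omega : n ≠ 0)
  have hN0 : (N : ℂ) ≠ 0 := by exact_mod_cast (by omega : N ≠ 0)
  have h1 : (momentProd A next π : ℂ) = ((n : ℂ) ^ sigmaCard next π)⁻¹ *
      ((N : ℂ) ^ Fintype.card (Starts π))⁻¹ *
        ∏ b : EdgeBlock next π, ((A * Aᴴ) ^ halfCard next π b).trace := by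
    rw [momentProd, Complex.ofReal_prod, ← sum_halfCard next π, ← Finset.prod_pow_eq_pow_sum,
      sigmaCard, ← Finset.card_univ, ← Finset.prod_const, ← Finset.prod_inv_distrib,
      ← Finset.prod_inv_distrib, ← Finset.prod_mul_distrib, ← Finset.prod_mul_distrib]
    refine Finset.prod_congr rfl fun b _ => ?_
    rw [moment_eq, smul_pow, Matrix.trace_smul, inv_pow, smul_eq_mul]
    ring
  rw [sum_graphTerm, weight]
  push_cast
  -- The powers of `n` with exponent `|σ(π)|` cancel, and the unpaired and paired indices together
  -- supply `N ^ |ι|`.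
  rw [h1, ← card_starts_add π, zpow_sub₀ hn0, zpow_natCast, zpow_natCast, pow_add]
  field_simp

end GraphSum

/-! ### The estimator as a Wick polynomial, and its covariance. -/

section Estimator

open MvPolynomial

variable {ι : Type*} [Fintype ι] [DecidableEq ι] {n N : ℕ}

/-- The Wick polynomial of the product of the entries of `D + X` along the circles `next`, for a
labelling of the vertices, as a polynomial in the real and imaginary parts of the entries of `X`. -/
noncomputable def wickPoly (D : Matrix (Fin n) (Fin N) ℂ) (next : Equiv.Perm ι) (f : ι → Fin n)
    (g : ι → Fin N) : MvPolynomial ((Fin n × Fin N) × Bool) ℂ :=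
  pairSum (fun i j => C (-edgeDelta ℂ next f g i j))
    (fun j => C (D (f j) (g j)) + zPoly (f j, g j))
    (fun i => C (star (D (f (next i)) (g i))) + zbarPoly (f (next i), g i))
    Finset.univ Finset.univ

theorem eval_wickPoly (D A : Matrix (Fin n) (Fin N) ℂ) (next : Equiv.Perm ι) (f : ι → Fin n)
    (g : ι → Fin N) :
    eval (fun t => ((if t.2 then (A t.1.1 t.1.2).re else (A t.1.1 t.1.2).im : ℝ) : ℂ))
        (wickPoly D next f g) =
      ∑ π : ι ≃. ι, (-1) ^ (rho₁ π).card * graphTerm (D + A) next f g π := by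
  have hz (z : ℂ) : (z.re : ℂ) + Complex.I * z.im = z := by
    rw [mul_comm]
    exact Complex.re_add_im z
  have hzb (z : ℂ) : (z.re : ℂ) - Complex.I * z.im = star z := by
    apply Complex.ext <;> simp
  rw [wickPoly, map_pairSum, pairSum_univ]
  refine Finset.sum_congr rfl fun π _ => ?_
  rw [graphTerm, ← pairTerm_const_mul]
  simp only [eval_C, map_add, zPoly, zbarPoly, map_sub, map_mul, eval_X, if_true, hz, hzb,
    Matrix.add_apply, star_add, neg_one_mul, Bool.false_eq_true, if_false]

theorem ofReal_estimator (hn : 1 ≤ n) (hN : 1 ≤ N) (p : ℕ) (D A : Matrix (Fin n) (Fin N) ℂ) :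
    (estimator p (D + A) : ℂ) =
      eval (fun t => ((if t.2 then (A t.1.1 t.1.2).re else (A t.1.1 t.1.2).im : ℝ) : ℂ))
        (C ((n : ℂ) * (N : ℂ) ^ p)⁻¹ *
          ∑ f : Fin p → Fin n, ∑ g : Fin p → Fin N, wickPoly D (finRotate p) f g) := by
  simp only [map_mul, eval_C, map_sum, eval_wickPoly]
  have h1 (π : Fin p ≃. Fin p) := weight_mul_momentProd hn hN (D + A) (finRotate p) 1 π
  rw [estimator, Complex.ofReal_sum]
  simp only [mul_assoc, Complex.ofReal_mul] at h1 ⊢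
  simp only [h1, pow_one, Fintype.card_fin]
  rw [Finset.sum_congr rfl fun f _ => Finset.sum_comm, Finset.sum_comm, Finset.mul_sum]
  refine Finset.sum_congr rfl fun π _ => ?_
  simp only [← Finset.mul_sum]
  push_cast
  ring

theorem sum_sum_type {κ α M : Type*} [Fintype κ] [DecidableEq κ] [Fintype α] [AddCommMonoid M]
    (h : (κ → α) → (κ → α) → M) :
    ∑ a, ∑ b, h a b = ∑ F : κ ⊕ κ → α, h (F ∘ Sum.inl) (F ∘ Sum.inr) := by
  rw [← Fintype.sum_prod_type' h]
  exact (Fintype.sum_equiv (Equiv.sumArrowEquivProdArrow κ κ α) _ _ fun F => rfl).symm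

variable {Ω : Type*} [MeasurableSpace Ω] {μ : Measure Ω} [IsProbabilityMeasure μ]
  {x : (Fin n × Fin N) × Bool → Ω → ℝ}

/-- The coefficient `-δ` is cancelled by the `δ` of Wick's theorem, so only the empty pairing
contributes. -/
theorem integral_wickPoly (hx : ∀ t, HasLaw (x t) (gaussianReal 0 (1 / 2)) μ) (hi : iIndepFun x μ)
    (D : Matrix (Fin n) (Fin N) ℂ) (next : Equiv.Perm ι) (f : ι → Fin n) (g : ι → Fin N) :
    ∫ ω, eval (fun t => (x t ω : ℂ)) (wickPoly D next f g) ∂μ =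
      pairSum (fun _ _ => 0) (fun j => D (f j) (g j)) (fun i => star (D (f (next i)) (g i)))
        Finset.univ Finset.univ := by
  rw [wickPoly, integral_pairSum hx hi]
  congr 1
  funext i j
  exact neg_add_cancel _

theorem integral_wickPoly_mul (hx : ∀ t, HasLaw (x t) (gaussianReal 0 (1 / 2)) μ)
    (hi : iIndepFun x μ) (p : ℕ) (D : Matrix (Fin n) (Fin N) ℂ)
    (F : Fin p ⊕ Fin p → Fin n) (G : Fin p ⊕ Fin p → Fin N) :
    ∫ ω, eval (fun t => (x t ω : ℂ)) (wickPoly D (finRotate p) (F ∘ Sum.inl) (G ∘ Sum.inl) *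
        wickPoly D (finRotate p) (F ∘ Sum.inr) (G ∘ Sum.inr)) ∂μ =
      ∑ π : (Fin p ⊕ Fin p) ≃. (Fin p ⊕ Fin p), if ∀ i, ∀ j ∈ π i, i.isLeft ≠ j.isLeft then
        graphTerm D (twoCircles p) F G π else 0 := by
  let c : Fin p ⊕ Fin p → Fin p ⊕ Fin p → ℂ := blockDiag
    (fun i j => -edgeDelta ℂ (finRotate p) (F ∘ Sum.inl) (G ∘ Sum.inl) i j)
    (fun i j => -edgeDelta ℂ (finRotate p) (F ∘ Sum.inr) (G ∘ Sum.inr) i j)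
  -- The product is a single pairing sum on both circles, with coefficient `-δ` inside a circle and
  -- `0` across; Wick's theorem turns these into `0` and `δ`.
  have h1 : wickPoly D (finRotate p) (F ∘ Sum.inl) (G ∘ Sum.inl) *
      wickPoly D (finRotate p) (F ∘ Sum.inr) (G ∘ Sum.inr) =
      pairSum (fun i j => C (c i j)) (fun j => C (D (F j) (G j)) + zPoly (F j, G j))
        (fun i => C (star (D (F (twoCircles p i)) (G i))) + zbarPoly (F (twoCircles p i), G i))
        Finset.univ Finset.univ := by
    rw [wickPoly, wickPoly, ← pairSum_blockDiag, Finset.univ_disjSum_univ]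
    congr 1
    · funext i j
      rcases i with i | i <;> rcases j with j | j <;> simp [blockDiag, c]
    · funext j
      rcases j with j | j <;> rfl
    · funext i
      rcases i with i | i <;> rfl
  rw [h1, integral_pairSum hx hi, pairSum_univ]
  refine Finset.sum_congr rfl fun π _ => ?_
  rw [graphTerm, ← pairTerm_ite]
  congr 1
  funext i j
  rcases i with i | i <;> rcases j with j | j <;>
    simp [blockDiag, c, edgeDelta, twoCircles]

/-- Writing the single surviving term as a sum over all `π` allows termwise subtraction from the
second moment. -/
theorem pairSum_zero (D : Matrix (Fin n) (Fin N) ℂ) (next : Equiv.Perm ι) (f : ι → Fin n)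
    (g : ι → Fin N) :
    pairSum (fun _ _ => 0) (fun j => D (f j) (g j)) (fun i => star (D (f (next i)) (g i)))
        Finset.univ Finset.univ =
      ∑ π : ι ≃. ι, if rho₁ π = ∅ then graphTerm D next f g π else 0 := by
  have h := fun π : ι ≃. ι => pairTerm_ite (fun _ _ => False) (edgeDelta ℂ next f g)
    (fun j => D (f j) (g j)) (fun i => star (D (f (next i)) (g i))) π
  simp only [if_false] at h
  rw [pairSum_univ]
  refine Finset.sum_congr rfl fun π _ => ?_
  rw [h π]
  refine if_congr ?_ rfl rfl
  rw [Finset.eq_empty_iff_forall_notMem]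
  simp only [mem_rho₁, Option.eq_none_iff_forall_ne_some]
  rfl

theorem integral_wickPoly_mul_integral (hx : ∀ t, HasLaw (x t) (gaussianReal 0 (1 / 2)) μ)
    (hi : iIndepFun x μ) (p : ℕ) (D : Matrix (Fin n) (Fin N) ℂ)
    (F : Fin p ⊕ Fin p → Fin n) (G : Fin p ⊕ Fin p → Fin N) :
    (∫ ω, eval (fun t => (x t ω : ℂ))
        (wickPoly D (finRotate p) (F ∘ Sum.inl) (G ∘ Sum.inl)) ∂μ) *
      (∫ ω, eval (fun t => (x t ω : ℂ))
        (wickPoly D (finRotate p) (F ∘ Sum.inr) (G ∘ Sum.inr)) ∂μ) =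
      ∑ π : (Fin p ⊕ Fin p) ≃. (Fin p ⊕ Fin p), if rho₁ π = ∅ then
        graphTerm D (twoCircles p) F G π else 0 := by
  rw [integral_wickPoly hx hi, integral_wickPoly hx hi, ← pairSum_zero, ← pairSum_blockDiag,
    Finset.univ_disjSum_univ]
  congr 1
  · funext i j
    rcases i with i | i <;> rcases j with j | j <;> rfl
  · funext j
    rcases j with j | j <;> rfl
  · funext i
    rcases i with i | i <;> rfl

/-- The covariance of two Wick polynomials, summed over the labellings of two circles. -/
theorem integral_sq_sub_sq_integral (hx : ∀ t, HasLaw (x t) (gaussianReal 0 (1 / 2)) μ)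
    (hi : iIndepFun x μ) (p : ℕ) (D : Matrix (Fin n) (Fin N) ℂ) (Q : MvPolynomial _ ℂ)
    (hQ : Q = ∑ f : Fin p → Fin n, ∑ g : Fin p → Fin N, wickPoly D (finRotate p) f g) :
    ∫ ω, eval (fun t => (x t ω : ℂ)) (Q * Q) ∂μ - (∫ ω, eval (fun t => (x t ω : ℂ)) Q ∂μ) ^ 2 =
      ∑ π ∈ SPR p, ∑ F : Fin p ⊕ Fin p → Fin n, ∑ G : Fin p ⊕ Fin p → Fin N,
        graphTerm D (twoCircles p) F G π := by
  have hI := integrable_eval_gaussian hx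
  have h1 : Q * Q = ∑ F : Fin p ⊕ Fin p → Fin n, ∑ G : Fin p ⊕ Fin p → Fin N,
      wickPoly D (finRotate p) (F ∘ Sum.inl) (G ∘ Sum.inl) *
        wickPoly D (finRotate p) (F ∘ Sum.inr) (G ∘ Sum.inr) := by
    rw [hQ, Finset.sum_mul_sum, sum_sum_type]
    refine Finset.sum_congr rfl fun F _ => ?_
    rw [Finset.sum_mul_sum, sum_sum_type]
  have h2 : ∫ ω, eval (fun t => (x t ω : ℂ)) (Q * Q) ∂μ =
      ∑ F : Fin p ⊕ Fin p → Fin n, ∑ G : Fin p ⊕ Fin p → Fin N,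
        ∫ ω, eval (fun t => (x t ω : ℂ)) (wickPoly D (finRotate p) (F ∘ Sum.inl) (G ∘ Sum.inl) *
          wickPoly D (finRotate p) (F ∘ Sum.inr) (G ∘ Sum.inr)) ∂μ := by
    rw [h1]
    simp only [map_sum (eval _)]
    rw [integral_finsetSum _ fun F _ => integrable_finsetSum _ fun G _ => hI _]
    exact Finset.sum_congr rfl fun F _ => integral_finsetSum _ fun G _ => hI _
  have h3 : ∫ ω, eval (fun t => (x t ω : ℂ)) Q ∂μ =
      ∑ f : Fin p → Fin n, ∑ g : Fin p → Fin N,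
        ∫ ω, eval (fun t => (x t ω : ℂ)) (wickPoly D (finRotate p) f g) ∂μ := by
    rw [hQ]
    simp only [map_sum (eval _)]
    rw [integral_finsetSum _ fun F _ => integrable_finsetSum _ fun G _ => hI _]
    exact Finset.sum_congr rfl fun F _ => integral_finsetSum _ fun G _ => hI _
  have h4 : (∫ ω, eval (fun t => (x t ω : ℂ)) Q ∂μ) ^ 2 =
      ∑ F : Fin p ⊕ Fin p → Fin n, ∑ G : Fin p ⊕ Fin p → Fin N,
        (∫ ω, eval (fun t => (x t ω : ℂ))
          (wickPoly D (finRotate p) (F ∘ Sum.inl) (G ∘ Sum.inl)) ∂μ) *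
        (∫ ω, eval (fun t => (x t ω : ℂ))
          (wickPoly D (finRotate p) (F ∘ Sum.inr) (G ∘ Sum.inr)) ∂μ) := by
    rw [h3, sq, Finset.sum_mul_sum, sum_sum_type]
    refine Finset.sum_congr rfl fun F _ => ?_
    rw [Finset.sum_mul_sum, sum_sum_type]
  rw [h2, h4, ← Finset.sum_sub_distrib, Finset.sum_comm' (t' := Finset.univ)
    (s' := fun _ => SPR p) (by simp)]
  refine Finset.sum_congr rfl fun F _ => ?_
  rw [← Finset.sum_sub_distrib, Finset.sum_comm' (t' := Finset.univ)
    (s' := fun _ => SPR p) (by simp)]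
  refine Finset.sum_congr rfl fun G _ => ?_
  rw [integral_wickPoly_mul hx hi, integral_wickPoly_mul_integral hx hi, SPR, Finset.sum_filter,
    ← Finset.sum_sub_distrib]
  refine Finset.sum_congr rfl fun π _ => ?_
  -- The empty pairing has no pair inside a circle, so it occurs in both sums and cancels.
  by_cases h5 : rho₁ π = ∅
  · have h6 : ∀ i, ∀ j ∈ π i, i.isLeft ≠ j.isLeft := fun i j hj => by
      have h7 : i ∉ rho₁ π := by simp [h5]
      rw [mem_rho₁] at h7
      simp [h7] at hj
    rw [if_pos h6, if_pos h5, if_neg (by simp [h5]), sub_self]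
  · rw [if_neg h5, sub_zero]
    by_cases h6 : ∀ i, ∀ j ∈ π i, i.isLeft ≠ j.isLeft
    · rw [if_pos h6, if_pos ⟨Finset.nonempty_iff_ne_empty.2 h5, h6⟩]
    · rw [if_neg h6, if_neg fun h => h6 h.2]

end Estimator

end GaussianMoments

/-! ### The variance formula. -/

open GaussianMoments
theorem mainTheorem3 {Ω : Type*} [MeasurableSpace Ω] (μ : Measure Ω) [IsProbabilityMeasure μ]
    (n N p : ℕ) (hn : 1 ≤ n) (hN : 1 ≤ N) (hp : 1 ≤ p)
    (D : Matrix (Fin n) (Fin N) ℂ) (X : Ω → Matrix (Fin n) (Fin N) ℂ)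
    (hX : IsStandardComplexGaussian X μ) :
    MemLp (fun ω => estimator p (D + X ω)) 2 μ ∧
    Var[fun ω => estimator p (D + X ω); μ] =
      ∑ π ∈ SPR p, (n : ℝ) ^ ((sigmaCard (twoCircles p) π : ℤ) - 2) / (N : ℝ) ^ (rho₁ π).card *
        vertexFactor (twoCircles p) π n N * momentProd D (twoCircles p) π ∧
    ∀ π ∈ SPR p,
      0 ≤ (n : ℝ) ^ ((sigmaCard (twoCircles p) π : ℤ) - 2) / (N : ℝ) ^ (rho₁ π).card *
        vertexFactor (twoCircles p) π n N * momentProd D (twoCircles p) π := by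
  let Q : MvPolynomial ((Fin n × Fin N) × Bool) ℂ :=
    ∑ f : Fin p → Fin n, ∑ g : Fin p → Fin N, wickPoly D (finRotate p) f g
  let a : ℂ := ((n : ℂ) * (N : ℂ) ^ p)⁻¹
  have hest (ω : Ω) : (estimator p (D + X ω) : ℂ) =
      MvPolynomial.eval (fun t => (entryPart X t ω : ℂ)) (MvPolynomial.C a * Q) :=
    ofReal_estimator hn hN p D (X ω)
  have hmem : MemLp (fun ω => estimator p (D + X ω)) 2 μ := by
    have h1 := (memLp_eval_gaussian hX.law (MvPolynomial.C a * Q) 2 (by simp)).re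
    refine h1.ae_eq (.of_forall fun ω => ?_)
    simp only [← hest]
    exact Complex.ofReal_re _
  refine ⟨hmem, ?_, fun π _ => weight_mul_momentProd_nonneg D (twoCircles p) 2 π⟩
  have h2 := integral_sq_sub_sq_integral hX.law hX.indep p D Q rfl
  have h3 : ((μ[fun ω => estimator p (D + X ω)] : ℝ) : ℂ) =
      a * ∫ ω, MvPolynomial.eval (fun t => (entryPart X t ω : ℂ)) Q ∂μ := by
    rw [← integral_complex_ofReal, ← integral_const_mul]
    simp [hest]
  have h4 : ((μ[(fun ω => estimator p (D + X ω)) ^ 2] : ℝ) : ℂ) =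
      a ^ 2 * ∫ ω, MvPolynomial.eval (fun t => (entryPart X t ω : ℂ)) (Q * Q) ∂μ := by
    rw [← integral_complex_ofReal, ← integral_const_mul]
    refine integral_congr_ae (.of_forall fun ω => ?_)
    simp only [Pi.pow_apply, Complex.ofReal_pow, hest, map_mul, MvPolynomial.eval_C]
    ring
  rw [variance_eq_sub hmem]
  -- The identity is checked in `ℂ`, where the Wick polynomials live. The squared prefactor `a ^ 2`
  -- is the normalization for two circles, with `k = 2` and `2 * p` indices.
  apply Complex.ofReal_injective
  rw [Complex.ofReal_sub, Complex.ofReal_pow, h3, h4, mul_pow, ← mul_sub, h2, Finset.mul_sum,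
    Complex.ofReal_sum]
  refine Finset.sum_congr rfl fun π _ => ?_
  refine Eq.trans ?_ (weight_mul_momentProd hn hN D (twoCircles p) 2 π).symm
  rw [Fintype.card_sum, Fintype.card_fin, inv_pow, mul_pow, ← pow_mul, mul_two]
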